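/- **Definitions.** A *weighted constrained workflow schema* $((S,<),U,\omega,C_\omega)$ consists of a finite partially ordered set $S$ of $k$ steps, a finite set $U$ of $n$ users, a function $\omega:2^S\times U\to\mathbb{Q}_{\ge 0}$ with $\omega(\emptyset,u)=0$ for all $u$, and a finite set $C$ of constraints $c=(T,\Theta)$, where $T\subseteq S$ and $\Theta$ is a family of functions $T\to U$, each with a weight function $\omega_c$ that assigns to every complete plan $\pi:S\to U$ a number $\omega_c(\pi)\in\mathbb{Q}_{\ge 0}$ with $\omega_c(\pi)=0$ if and only if $\pi|_T\in\Theta$. The weighted constraint $(c,\omega_c)$ is *user-independent* if $\omega_c(\pi)=\omega_c(\theta\circ\pi)$ for every complete plan $\pi$ and every permutation $\theta$ of $U$. Put $$\omega_C(\pi)=\sum_{c\in C}\omega_c(\pi),\qquad \omega_A(\pi)=\sum_{u\in U}\omega(\pi^{-1}(u),u).$$ A complete plan $\pi$ is *Pareto optimal* if there is no complete plan $\pi'$ with $\omega_C(\pi')\le\omega_C(\pi)$, $\omega_A(\pi')\le\omega_A(\pi)$ and $\omega_C(\pi')+\omega_A(\pi')<\omega_C(\pi)+\omega_A(\pi)$.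 Two plans are *weight-equal* if they have the same $\omega_C$ and the same $\omega_A$. A *Pareto front* is an inclusion-maximal set of pairwise non-weight-equal Pareto optimal complete plans. *Computation.* An instance is given by its list of $k$ steps, its list of $n$ users, and a bit string that describes the rest of the schema in some fixed way; its size $N$ is $k+n$ plus the length of that string. Programs are sequential programs on binary trees, built from the empty tree, the identity, the two components of a pair, pairing, composition, branching on whether a tree is empty, and while loops; each operation takes one step. (A step is a constant number of operations of a random access machine.) Weights are written as reduced fractions in binary, and plans as lists of users. **Theorem.** Consider a class of weighted constrained workflow schemas, so described, in which all weighted constraints are user-independent and for which $\omega_A(\pi)$ and $\omega_C(\pi)$ can each be computed, from the instance and a complete plan $\pi$, by one program in a number of steps polynomial in $N$. Then there are a program and a polynomial $p$ such that, on every instance of the class, the program outputs a list without repetitions of the elements of a Pareto front, in at most $2^{k\log_2 k}\,p(N)$ steps (where $k\log_2 k$ is read as $0$ for $k=0$). That is, a Pareto front can be computed in time $O^*(2^{k\log_2 k})$. -/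

import Mathlib

namespace BOWSP

/-! ## Weighted constrained workflow schemas -/

/-- A workflow constraint `(T, Θ)` : a scope `T ⊆ S` and a family `Θ` of functions `T → U`. -/
structure WConstraint (S U : Type*) where
  scope : Finset S
  family : Set ({s // s ∈ scope} → U)

/-- A complete plan `π : S → U` satisfies `(T, Θ)` if `π|_T ∈ Θ`. -/
def WConstraint.SatisfiedBy {S U : Type*} (c : WConstraint S U) (π : S → U) : Prop :=
  (fun t : {s // s ∈ c.scope} => π t.1) ∈ c.family

/-- A weighted constrained workflow schema `((S, <), U, ω, C_ω)` : a partial order on the steps,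
a weighted set-authorization function `ω : 2^S × U → ℚ≥0`, and a finite set `C` of constraints, each
`c ∈ C` with a weight function `ω_c` on complete plans that vanishes exactly on the plans
satisfying `c`. -/
structure Schema (S U : Type*) where
  order : PartialOrder S
  omega : Finset S → U → ℚ≥0
  omega_empty : ∀ u, omega ∅ u = 0
  constraints : Finset (WConstraint S U)
  weight : WConstraint S U → (S → U) → ℚ≥0
  weight_eq_zero_iff : ∀ c ∈ constraints, ∀ π : S → U, weight c π = 0 ↔ c.SatisfiedBy π

namespace Schema

variable {S U : Type*}

/-- All weighted constraints are user-independent: `ω_c (θ ∘ π) = ω_c π` for each permutation `θ`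
of the users. -/
def UserIndependent (W : Schema S U) : Prop :=
  ∀ c ∈ W.constraints, ∀ (θ : Equiv.Perm U) (π : S → U), W.weight c π = W.weight c (θ ∘ π)

/-- The constraint weight `ω_C(π) = ∑_{c ∈ C} ω_c(π)`. -/
def constraintWeight (W : Schema S U) (π : S → U) : ℚ≥0 :=
  ∑ c ∈ W.constraints, W.weight c π

/-- The authorization weight `ω_A(π) = ∑_{u ∈ U} ω(π⁻¹(u), u)`. -/
def authWeight [Fintype S] [Fintype U] [DecidableEq U] (W : Schema S U) (π : S → U) : ℚ≥0 :=
  ∑ u, W.omega (Finset.univ.filter fun s => π s = u) u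

/-- `π` is Pareto optimal: no complete plan is at least as good in both weights and has a smaller
total. -/
def ParetoOptimal [Fintype S] [Fintype U] [DecidableEq U] (W : Schema S U) (π : S → U) : Prop :=
  ¬ ∃ π' : S → U, W.constraintWeight π' ≤ W.constraintWeight π ∧
    W.authWeight π' ≤ W.authWeight π ∧
    W.constraintWeight π' + W.authWeight π' < W.constraintWeight π + W.authWeight π

def WeightEqual [Fintype S] [Fintype U] [DecidableEq U] (W : Schema S U) (π π' : S → U) : Prop :=
  W.constraintWeight π = W.constraintWeight π' ∧ W.authWeight π = W.authWeight π'

/-- A Pareto front: a maximal set of pairwise non-weight-equal Pareto optimal plans. -/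
def IsParetoFront [Fintype S] [Fintype U] [DecidableEq U] (W : Schema S U)
    (F : Set (S → U)) : Prop :=
  Maximal (fun G : Set (S → U) =>
    (∀ π ∈ G, W.ParetoOptimal π) ∧ G.Pairwise fun π π' => ¬ W.WeightEqual π π') F

end Schema

/-! ## The machine model

Programs over binary trees (pure LISP without side effects): the operations are forming the empty
tree, forming a pair, taking the two components of a pair, testing for the empty tree, composition
and while loops. Each operation takes one step. A tree is held as a pointer, so each step is a
constant number of operations of a random access machine (or pointer machine); arithmetic on
numbers is not available in one step. -/

/-- Binary trees. -/
inductive Data where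
  | nil : Data
  | cons : Data → Data → Data

namespace Data

def hd : Data → Data
  | nil => nil
  | cons a _ => a

def tl : Data → Data
  | nil => nil
  | cons _ b => b

/-- Lists of trees as trees. -/
def ofList : List Data → Data
  | [] => nil
  | a :: l => cons a (ofList l)

def ofBool : Bool → Data
  | false => nil
  | true => cons nil nil

/-- Bit strings. -/
def ofBits (l : List Bool) : Data := ofList (l.map ofBool)

/-- Unary representation, used for the number of steps, the number of users, and the name of a
single user. -/
def ofUnary (m : ℕ) : Data := ofList (List.replicate m nil)

/-- A weight: numerator and denominator of the reduced fraction, both in binary. -/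
def ofWeight (q : ℚ≥0) : Data := cons (ofBits q.num.bits) (ofBits q.den.bits)

/-- A complete plan: the list of the users assigned to the steps `0, …, k - 1`. -/
def ofPlan {k n : ℕ} (π : Fin k → Fin n) : Data :=
  ofList (List.ofFn fun s => ofUnary (π s : ℕ))

/-- A list of complete plans. -/
def ofPlans {k n : ℕ} (L : List (Fin k → Fin n)) : Data := ofList (L.map ofPlan)

end Data

/-- Programs, read as partial functions from trees to trees. -/
inductive Prog where
  | nil : Prog
  | skip : Prog
  | hd : Prog
  | tl : Prog
  | pair : Prog → Prog → Prog
  | seq : Prog → Prog → Prog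
  | cond : Prog → Prog → Prog → Prog
  | loop : Prog → Prog → Prog

open Data in
/-- `Runs P x y t` : on input `x` the program `P` halts with output `y` after exactly `t` steps.
`seq f g` runs `f` and then `g`; `cond c f g` runs `f` if `c` gives a nonempty tree and `g`
otherwise; `loop c f` repeats `f` as long as `c` gives a nonempty tree. -/
inductive Runs : Prog → Data → Data → ℕ → Prop where
  | nil (x : Data) : Runs .nil x .nil 1
  | skip (x : Data) : Runs .skip x x 1
  | hd (x : Data) : Runs .hd x x.hd 1
  | tl (x : Data) : Runs .tl x x.tl 1
  | pair {f g : Prog} {x y z : Data} {s t : ℕ} :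
      Runs f x y s → Runs g x z t → Runs (.pair f g) x (.cons y z) (s + t + 1)
  | seq {f g : Prog} {x y z : Data} {s t : ℕ} :
      Runs f x y s → Runs g y z t → Runs (.seq f g) x z (s + t + 1)
  | cond_true {c f g : Prog} {x a b y : Data} {s t : ℕ} :
      Runs c x (.cons a b) s → Runs f x y t → Runs (.cond c f g) x y (s + t + 1)
  | cond_false {c f g : Prog} {x y : Data} {s t : ℕ} :
      Runs c x .nil s → Runs g x y t → Runs (.cond c f g) x y (s + t + 1)
  | loop_stop {c f : Prog} {x : Data} {s : ℕ} :
      Runs c x .nil s → Runs (.loop c f) x x (s + 1)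
  | loop_step {c f : Prog} {x a b y z : Data} {r s t : ℕ} :
      Runs c x (.cons a b) r → Runs f x y s → Runs (.loop c f) y z t →
        Runs (.loop c f) x z (r + s + t + 1)

/-! ## Classes of instances and their descriptions -/

/-- A class of instances of the problem. The instance `i` has the steps `0, …, k i - 1`, the users
`0, …, n i - 1` and the schema `schema i`, whose remaining components (order, set-authorization
function, weighted constraints) are given to a program by the bit string `desc i`. -/
structure InstanceClass (I : Type*) where
  k : I → ℕ
  n : I → ℕ
  schema : ∀ i, Schema (Fin (k i)) (Fin (n i))
  desc : I → List Bool

namespace InstanceClass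

variable {I : Type*}

/-- The input that a program gets: the steps, the users and the description. -/
def input (F : InstanceClass I) (i : I) : Data :=
  .cons (.ofUnary (F.k i)) (.cons (.ofUnary (F.n i)) (.ofBits (F.desc i)))

/-- The input size. -/
def size (F : InstanceClass I) (i : I) : ℕ := F.k i + F.n i + (F.desc i).length

/-- A weight of complete plans is computable in polynomial time: one program computes it from the
input and the plan, in a number of steps polynomial in the input size. -/
def PolyTimeComputable (F : InstanceClass I)
    (w : ∀ i, (Fin (F.k i) → Fin (F.n i)) → ℚ≥0) : Prop :=
  ∃ (Q : Prog) (q : Polynomial ℕ), ∀ (i : I) (π : Fin (F.k i) → Fin (F.n i)),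
    ∃ t : ℕ, Runs Q (.cons (F.input i) (.ofPlan π)) (.ofWeight (w i π)) t ∧ t ≤ q.eval (F.size i)

end InstanceClass

end BOWSP

/-!
A plan is determined by the partition of the steps into the blocks of steps that share a user,
together with an injective assignment of users to the blocks. By user-independence the constraint
weight depends only on the partition, so for each partition an assignment of minimal authorization
weight suffices, and the Pareto front can be found among at most `k ^ k = 2 ^ (k log₂ k)` candidates:

* If `n ≤ k`, all `n ^ k ≤ k ^ k` plans are candidates.
* If `k < n`, each of the `k ^ k` functions `φ : Fin k → Fin k` is read as an ordered partition into
  the blocks `φ ⁻¹ {0}`, `φ ⁻¹ {1}`, … (some of them empty), and gives the candidate in which the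
  blocks choose, one after the other, the cheapest user that is left (`greedyPlan`). Every optimal
  assignment is the outcome of such a serial dictatorship for a suitable order of the blocks
  (`exists_order_of_optimal`, by a trading-cycle argument; ties are broken by the names of the users),
  so the candidates contain, for each plan, one that is at least as good
  (`Schema.exists_candidate_le`). Only weights of complete plans can be computed, but as there is a
  user to spare, the costs of two users for one block can be compared by two complete plans that
  differ in this block only (`Schema.betterUser_iff`).

The candidates are sorted lexicographically by constraint weight and authorization weight (merge sort
costs a factor `log (k ^ k) ≤ k ^ 2`), and a sweep keeps those that improve the authorization weight;
what is kept is a Pareto front (`Schema.front_spec`).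

On the side of the machine, `Computes` says that one program computes a family of trees from another
one within given time bounds. It is closed under pairing, composition, branching, loops paid for by a
potential, and loops over lists; from these rules the programs are put together: binary arithmetic
for the comparison of weights, the enumeration of tuples, the serial dictatorship and merge sort.
Weights have polynomial length because the height of a tree grows by at most one in each step
(`Runs.height_le`).
-/

open Polynomial

namespace BOWSP

/-! ### Computing one family of trees from another -/

/-- One program computes `b x` from `a x` for all `x` in `D`, in at most `(M x + 1) * p (N x)` steps
for some polynomial `p`. The index `x` plays the role of an environment: `a x` is the encoding of
everything the program can see and `b x` the value of an expression in that environment. `M` is the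
part of the running time that need not be polynomial in the size `N`; polynomial time is `M = 0`. -/
def Computes {α : Type*} (D : α → Prop) (M N : α → ℕ) (a b : α → Data) : Prop :=
  ∃ (P : Prog) (p : ℕ[X]), ∀ x, D x → ∃ t, Runs P (a x) (b x) t ∧ t ≤ (M x + 1) * p.eval (N x)

theorem eval_mono_nat (p : ℕ[X]) {m n : ℕ} (h : m ≤ n) : p.eval m ≤ p.eval n := by
  rw [eval_eq_sum, eval_eq_sum]
  exact Finset.sum_le_sum fun i _ => Nat.mul_le_mul le_rfl (Nat.pow_le_pow_left h i)

namespace Computes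

variable {α γ : Type*} {D D' : α → Prop} {M M' N N' : α → ℕ} {a b c d : α → Data}

theorem id : Computes D M N a a :=
  ⟨.skip, 1, fun x _ => ⟨1, .skip _, by simp⟩⟩

theorem nil : Computes D M N a fun _ => .nil :=
  ⟨.nil, 1, fun x _ => ⟨1, .nil _, by simp⟩⟩

theorem pair (hb : Computes D M N a b) (hc : Computes D M N a c) :
    Computes D M N a fun x => .cons (b x) (c x) := by
  obtain ⟨P, p, hP⟩ := hb
  obtain ⟨Q, q, hQ⟩ := hc
  refine ⟨.pair P Q, p + q + 1, fun x hx => ?_⟩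
  obtain ⟨s, hs, hs'⟩ := hP x hx
  obtain ⟨t, ht, ht'⟩ := hQ x hx
  refine ⟨_, .pair hs ht, ?_⟩
  simp only [eval_add, eval_one]
  nlinarith

theorem comp (hb : Computes D M N a b) (hc : Computes D M N b c) : Computes D M N a c := by
  obtain ⟨P, p, hP⟩ := hb
  obtain ⟨Q, q, hQ⟩ := hc
  refine ⟨.seq P Q, p + q + 1, fun x hx => ?_⟩
  obtain ⟨s, hs, hs'⟩ := hP x hx
  obtain ⟨t, ht, ht'⟩ := hQ x hx
  refine ⟨_, .seq hs ht, ?_⟩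
  simp only [eval_add, eval_one]
  nlinarith

theorem hd (hb : Computes D M N a b) : Computes D M N a fun x => (b x).hd :=
  hb.comp ⟨.hd, 1, fun x _ => ⟨1, .hd _, by simp⟩⟩

theorem tl (hb : Computes D M N a b) : Computes D M N a fun x => (b x).tl :=
  hb.comp ⟨.tl, 1, fun x _ => ⟨1, .tl _, by simp⟩⟩

theorem fst (h : Computes D M N a fun x => .cons (b x) (c x)) : Computes D M N a b := h.hd

theorem snd (h : Computes D M N a fun x => .cons (b x) (c x)) : Computes D M N a c := h.tl

theorem const (e : Data) : Computes D M N a fun _ => e := by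
  induction e with
  | nil => exact nil
  | cons e f he hf => exact he.pair hf

/-- A program may be used on any family of inputs that lie in its domain, at the price of a
polynomial change of the bounds. -/
theorem sub {D' : γ → Prop} {M' N' : γ → ℕ} {a' b' : γ → Data} (h : Computes D M N a b) (r : ℕ[X])
    (hb : ∀ y, D' y → ∃ x, D x ∧ a x = a' y ∧ b x = b' y ∧
      M x + 1 ≤ (M' y + 1) * r.eval (N' y) ∧ N x ≤ r.eval (N' y)) :
    Computes D' M' N' a' b' := by
  obtain ⟨P, p, hP⟩ := h
  refine ⟨P, r * p.comp r, fun y hy => ?_⟩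
  obtain ⟨x, hx, ha, hb, hM, hN⟩ := hb y hy
  obtain ⟨t, ht, ht'⟩ := hP x hx
  refine ⟨t, ha ▸ hb ▸ ht, ht'.trans ?_⟩
  rw [eval_mul, eval_comp, ← mul_assoc]
  exact Nat.mul_le_mul hM (eval_mono_nat p hN)

/-- Calling a subroutine on a computed argument. -/
theorem call {D' : γ → Prop} {M' N' : γ → ℕ} {a' : γ → Data} (h : Computes D M N a b) (g : γ → α)
    (r : ℕ[X]) (harg : Computes D' M' N' a' fun y => a (g y))
    (hb : ∀ y, D' y → D (g y) ∧ M (g y) + 1 ≤ (M' y + 1) * r.eval (N' y) ∧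
      N (g y) ≤ r.eval (N' y)) :
    Computes D' M' N' a' fun y => b (g y) :=
  harg.comp (h.sub r fun y hy => ⟨g y, (hb y hy).1, rfl, rfl, (hb y hy).2.1, (hb y hy).2.2⟩)

/-- Calling a subroutine under the same bounds. -/
theorem call' {D' : γ → Prop} {M' N' : γ → ℕ} {a' : γ → Data} (h : Computes D M N a b) (g : γ → α)
    (harg : Computes D' M' N' a' fun y => a (g y))
    (hb : ∀ y, D' y → D (g y) ∧ M (g y) ≤ M' y ∧ N (g y) ≤ N' y) :
    Computes D' M' N' a' fun y => b (g y) :=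
  h.call g (X + 1) harg fun y hy => by
    obtain ⟨h1, h2, h3⟩ := hb y hy
    refine ⟨h1, ?_, by simp; omega⟩
    simp only [eval_add, eval_X, eval_one]
    nlinarith

theorem mono (h : Computes D M N a b) (hD : ∀ x, D' x → D x) (hM : ∀ x, D' x → M x ≤ M' x) :
    Computes D' M' N a b :=
  h.call' (fun x => x) id fun x hx => ⟨hD x hx, hM x hx, le_rfl⟩

theorem congr (h : Computes D M N a b) (hb : ∀ x, D x → b x = c x) : Computes D M N a c := by
  obtain ⟨P, p, hP⟩ := h
  exact ⟨P, p, fun x hx => hb x hx ▸ hP x hx⟩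

/-- Branching; the test is a tree that is nonempty exactly if `p` holds. -/
theorem ite {p : α → Prop} [DecidablePred p] (hc : Computes D M N a c)
    (hp : ∀ x, D x → (c x ≠ .nil ↔ p x)) (hb : Computes (fun x => D x ∧ p x) M N a b)
    (hd : Computes (fun x => D x ∧ ¬ p x) M N a d) :
    Computes D M N a fun x => if p x then b x else d x := by
  obtain ⟨P, p', hP⟩ := hc
  obtain ⟨Q, q, hQ⟩ := hb
  obtain ⟨R, r, hR⟩ := hd
  refine ⟨.cond P Q R, p' + q + r + 1, fun x hx => ?_⟩
  obtain ⟨s, hs, hs'⟩ := hP x hx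
  simp only [eval_add, eval_one]
  by_cases h : p x
  · obtain ⟨t, ht, ht'⟩ := hQ x ⟨hx, h⟩
    obtain ⟨e, f, hef⟩ : ∃ e f, c x = .cons e f := by
      have := (hp x hx).2 h
      cases hcx : c x with
      | nil => exact absurd hcx this
      | cons e f => exact ⟨e, f, rfl⟩
    rw [hef] at hs
    refine ⟨_, by simpa [h] using Runs.cond_true hs ht, ?_⟩
    nlinarith [Nat.zero_le ((M x + 1) * r.eval (N x))]
  · obtain ⟨t, ht, ht'⟩ := hR x ⟨hx, h⟩
    have hn : c x = .nil := by
      by_contra hne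
      exact h ((hp x hx).1 hne)
    rw [hn] at hs
    refine ⟨_, by simpa [h] using Runs.cond_false hs ht, ?_⟩
    nlinarith [Nat.zero_le ((M x + 1) * q.eval (N x))]

/-- Iteration. The potential `Φ` pays for the body of the loop, and `out` is an invariant that
names the final state. -/
theorem loop {Φ : α → ℕ} {out : α → Data} (step : α → α) (hc : Computes D 0 N a c)
    (hbody : Computes (fun x => D x ∧ c x ≠ .nil) M N a fun x => a (step x))
    (hstep : ∀ x, D x → c x ≠ .nil → D (step x) ∧ N (step x) ≤ N x ∧
      M x + 1 + Φ (step x) ≤ Φ x ∧ out (step x) = out x)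
    (hexit : ∀ x, D x → c x = .nil → out x = a x) : Computes D Φ N a out := by
  obtain ⟨P, p, hP⟩ := hc
  obtain ⟨Q, q, hQ⟩ := hbody
  refine ⟨.loop P Q, p + q + 1, ?_⟩
  have key : ∀ (m : ℕ) (x : α), Φ x ≤ m → D x →
      ∃ t, Runs (.loop P Q) (a x) (out x) t ∧ t ≤ (Φ x + 1) * (p + q + 1).eval (N x) := by
    intro m
    induction m with
    | zero =>
      intro x hm hx
      obtain ⟨s, hs, hs'⟩ := hP x hx
      by_cases hn : c x = .nil
      · rw [hn] at hs
        refine ⟨s + 1, by rw [hexit x hx hn]; exact Runs.loop_stop hs, ?_⟩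
        simp only [eval_add, eval_one, Pi.zero_apply] at hs' ⊢
        nlinarith [Nat.zero_le (Φ x * (p.eval (N x) + q.eval (N x) + 1))]
      · have := (hstep x hx hn).2.2.1
        omega
    | succ m ih =>
      intro x hm hx
      obtain ⟨s, hs, hs'⟩ := hP x hx
      by_cases hn : c x = .nil
      · rw [hn] at hs
        refine ⟨s + 1, by rw [hexit x hx hn]; exact Runs.loop_stop hs, ?_⟩
        simp only [eval_add, eval_one, Pi.zero_apply] at hs' ⊢
        nlinarith [Nat.zero_le (Φ x * (p.eval (N x) + q.eval (N x) + 1))]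
      · obtain ⟨h1, h2, h3, h4⟩ := hstep x hx hn
        obtain ⟨t, ht, ht'⟩ := hQ x ⟨hx, hn⟩
        obtain ⟨u, hu, hu'⟩ := ih (step x) (by omega) h1
        obtain ⟨e, f, hef⟩ : ∃ e f, c x = .cons e f := by
          cases hcx : c x with
          | nil => exact absurd hcx hn
          | cons e f => exact ⟨e, f, rfl⟩
        rw [hef] at hs
        refine ⟨_, h4 ▸ Runs.loop_step hs ht hu, ?_⟩
        have h5 := hu'.trans (Nat.mul_le_mul le_rfl (eval_mono_nat (p + q + 1) h2))
        have h6 : (M x + 1 + Φ (step x) + 1) * (p + q + 1).eval (N x) ≤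
            (Φ x + 1) * (p + q + 1).eval (N x) := Nat.mul_le_mul (by omega) le_rfl
        simp only [eval_add, eval_one, Pi.zero_apply] at hs' h5 h6 ⊢
        nlinarith [Nat.zero_le (M x * p.eval (N x)), Nat.zero_le (M x)]
  exact fun x hx => key _ x le_rfl hx

end Computes

/-! ### Lists -/

theorem Data.ofList_eq_nil_iff {l : List Data} : Data.ofList l = .nil ↔ l = [] := by
  cases l <;> simp [Data.ofList]

namespace Computes

variable {α : Type*} {D : α → Prop} {M N : α → ℕ} {a b c : α → Data}

/-- A loop over the elements of a list. The body has to work only on the states that are reached by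
a prefix of the list. -/
theorem foldl {β σ : α → Type*} {M₂ : α → ℕ} (encS : ∀ x, σ x → Data) (encB : ∀ x, β x → Data)
    (l : ∀ x, List (β x)) (init : ∀ x, σ x) (step : ∀ x, σ x → β x → σ x) (r : ℕ[X])
    (hl : Computes D M N a fun x => .ofList ((l x).map (encB x)))
    (hi : Computes D M N a fun x => encS x (init x))
    (hs : Computes
      (fun y : Σ x, σ x × β x => D y.1 ∧ ∃ pre post, l y.1 = pre ++ y.2.2 :: post ∧
        y.2.1 = pre.foldl (step y.1) (init y.1))
      (fun y => M₂ y.1) (fun y => N y.1)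
      (fun y => .cons (a y.1) (.cons (encS y.1 y.2.1) (encB y.1 y.2.2)))
      (fun y => encS y.1 (step y.1 y.2.1 y.2.2)))
    (hlen : ∀ x, D x → (l x).length * (M₂ x + 1) ≤ (M x + 1) * r.eval (N x)) :
    Computes D M N a fun x => encS x ((l x).foldl (step x) (init x)) := by
  -- The states of the loop: the environment, the state of the fold and the rest of the list.
  let D' : (Σ x, σ x × List (β x)) → Prop := fun z => D z.1 ∧ ∃ pre, l z.1 = pre ++ z.2.2 ∧
    z.2.1 = pre.foldl (step z.1) (init z.1)
  let env : (Σ x, σ x × List (β x)) → Data := fun z =>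
    .cons (a z.1) (.cons (encS z.1 z.2.1) (.ofList (z.2.2.map (encB z.1))))
  let next : (Σ x, σ x × List (β x)) → (Σ x, σ x × List (β x)) := fun z =>
    match z with
    | ⟨x, s, []⟩ => ⟨x, s, []⟩
    | ⟨x, s, b :: l⟩ => ⟨x, step x s b, l⟩
  have hloop : Computes D' (fun z => z.2.2.length * (M₂ z.1 + 1)) (fun z => N z.1) env
      (fun z => .cons (a z.1) (.cons (encS z.1 (z.2.2.foldl (step z.1) z.2.1)) .nil)) := by
    refine loop (M := fun z => M₂ z.1) (c := fun z => .ofList (z.2.2.map (encB z.1))) next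
      id.snd.snd ?_ ?_ ?_
    · have h1 : Computes (fun z => D' z ∧ Data.ofList (z.2.2.map (encB z.1)) ≠ .nil)
          (fun z => M₂ z.1) (fun z => N z.1) env (fun z => encS (next z).1 (next z).2.1) := by
        have h2 : Computes (fun z => D' z ∧ Data.ofList (z.2.2.map (encB z.1)) ≠ .nil)
          (fun z => M₂ z.1) (fun z => N z.1) env
          (fun z => .cons (a z.1) (.cons (encS z.1 z.2.1) (Data.ofList (z.2.2.map (encB z.1))).hd)) :=
          id.fst.pair (id.snd.fst.pair id.snd.snd.hd)
        refine h2.comp (hs.sub (X + 1) ?_)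
        rintro ⟨x, s, _ | ⟨b, l'⟩⟩ ⟨⟨hD, pre, hpre, hfold⟩, hne⟩
        · exact absurd rfl hne
        · refine ⟨⟨x, s, b⟩, ⟨hD, pre, l', hpre, hfold⟩, rfl, rfl, ?_, by simp⟩
          simp only [eval_add, eval_X, eval_one]
          nlinarith
      refine (id.fst.pair (h1.pair id.snd.snd.tl)).congr ?_
      rintro ⟨x, s, _ | ⟨b, l'⟩⟩ ⟨⟨hD, pre, hpre, hfold⟩, hne⟩
      · exact absurd rfl hne
      · rfl
    · rintro ⟨x, s, _ | ⟨b, l'⟩⟩ ⟨hD, pre, hpre, hfold⟩ hne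
      · exact absurd rfl hne
      · refine ⟨⟨hD, pre ++ [b], by simpa using hpre, ?_⟩, le_rfl, ?_, rfl⟩
        · simp only [] at hfold
          simp [next, hfold]
        · simp only [next, List.length_cons]
          nlinarith
    · rintro ⟨x, s, _ | ⟨b, l'⟩⟩ _ hn
      · rfl
      · simp [Data.ofList] at hn
  have h3 : Computes D M N a fun x =>
      env ⟨x, init x, l x⟩ := id.pair (hi.pair hl)
  refine (hloop.call (fun x => ⟨x, init x, l x⟩) (r + X + 1) h3 ?_).snd.fst
  intro x hx
  refine ⟨⟨hx, [], rfl, rfl⟩, ?_, by simp; omega⟩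
  have := hlen x hx
  simp only [eval_add, eval_X, eval_one]
  nlinarith [Nat.zero_le ((M x + 1) * N x)]

/-- Prepending the reversal of a list. -/
theorem revAppend : Computes (fun _ => True) (fun x : List Data × List Data => x.1.length) 0
    (fun x => .cons (.ofList x.1) (.ofList x.2)) (fun x => .ofList (x.1.reverse ++ x.2)) := by
  have h := foldl (α := List Data × List Data) (β := fun _ => Data) (σ := fun _ => List Data)
    (D := fun _ => True) (M := fun x => x.1.length) (N := 0) (M₂ := 0)
    (a := fun x => .cons (.ofList x.1) (.ofList x.2)) (fun _ => .ofList) (fun _ d => d)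
    (fun x => x.1) (fun x => x.2) (fun _ s b => b :: s) 1
    (by simpa using id.fst) id.snd (id.snd.snd.pair id.snd.fst)
    (by intro x _; simp)
  exact h.congr fun x _ => by simp

theorem reverseAppend {l m : α → List Data} (r : ℕ[X])
    (hl : Computes D M N a fun x => .ofList (l x))
    (hm : Computes D M N a fun x => .ofList (m x))
    (hlen : ∀ x, D x → (l x).length ≤ (M x + 1) * r.eval (N x)) :
    Computes D M N a fun x => .ofList ((l x).reverse ++ m x) :=
  revAppend.call (fun x => (l x, m x)) (r + 1) (hl.pair hm) fun x hx => by
    have := hlen x hx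
    refine ⟨trivial, ?_, by simp⟩
    simp only [eval_add, eval_one]
    nlinarith

theorem reverse {l : α → List Data} (r : ℕ[X]) (hl : Computes D M N a fun x => .ofList (l x))
    (hlen : ∀ x, D x → (l x).length ≤ (M x + 1) * r.eval (N x)) :
    Computes D M N a fun x => .ofList (l x).reverse := by
  simpa using reverseAppend (m := fun _ => []) r hl nil hlen

theorem map {β γ : α → Type*} {M₂ : α → ℕ} (encB : ∀ x, β x → Data) (encC : ∀ x, γ x → Data)
    (l : ∀ x, List (β x)) (f : ∀ x, β x → γ x) (r : ℕ[X])
    (hl : Computes D M N a fun x => .ofList ((l x).map (encB x)))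
    (hf : Computes (fun y : Σ x, β x => D y.1 ∧ y.2 ∈ l y.1) (fun y => M₂ y.1) (fun y => N y.1)
      (fun y => .cons (a y.1) (encB y.1 y.2)) (fun y => encC y.1 (f y.1 y.2)))
    (hlen : ∀ x, D x → (l x).length * (M₂ x + 1) ≤ (M x + 1) * r.eval (N x)) :
    Computes D M N a fun x => .ofList (((l x).map (f x)).map (encC x)) := by
  have h := foldl (σ := fun x => List (γ x)) (D := D) (M := M) (N := N) (M₂ := M₂) (a := a)
    (fun x s => .ofList (s.map (encC x))) encB l (fun _ => []) (fun x s b => f x b :: s) r hl nil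
    (by
      refine Computes.pair ?_ id.snd.fst
      refine hf.call' (fun y : Σ x, List (γ x) × β x => (⟨y.1, y.2.2⟩ : Σ x, β x)) (id.fst.pair id.snd.snd) ?_
      rintro ⟨x, s, b⟩ ⟨hD, pre, post, hl, _⟩
      simp only at hl
      exact ⟨⟨hD, by simp [hl]⟩, le_rfl, le_rfl⟩)
    hlen
  have hfold : ∀ x (l : List (β x)) (s : List (γ x)),
      l.foldl (fun s b => f x b :: s) s = (l.map (f x)).reverse ++ s := by
    intro x l
    induction l with
    | nil => simp
    | cons b l ih => intro s; simp [ih]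
  refine (reverse r h fun x hx => ?_).congr fun x _ => ?_
  · rw [hfold]
    have := hlen x hx
    simp only [List.append_nil, List.map_reverse, List.length_reverse, List.length_map]
    nlinarith
  · rw [hfold]
    simp

end Computes

/-! ### Binary arithmetic -/

/-- The number with the given binary digits, the least significant digit first. Leading zeros (at
the end of the list) are allowed. -/
def bitVal : List Bool → ℕ
  | [] => 0
  | b :: l => b.toNat + 2 * bitVal l

theorem bitVal_append (l m : List Bool) :
    bitVal (l ++ m) = bitVal l + 2 ^ l.length * bitVal m := by
  induction l with
  | nil => simp [bitVal]
  | cons b l ih => simp [bitVal, ih, pow_succ]; ring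

theorem bitVal_bits (n : ℕ) : bitVal n.bits = n := by
  induction n using Nat.binaryRec' with
  | zero => simp [bitVal]
  | bit b n h ih =>
    rw [Nat.bits_append_bit n b h, bitVal, ih, Nat.bit_val]
    omega

theorem bitVal_eq_head_tail (l : List Bool) :
    bitVal l = (l.headD false).toNat + 2 * bitVal l.tail := by
  cases l <;> simp [bitVal]

theorem Data.hd_ofBits (l : List Bool) : (Data.ofBits l).hd = .ofBool (l.headD false) := by
  cases l <;> rfl

theorem Data.tl_ofBits (l : List Bool) : (Data.ofBits l).tl = .ofBits l.tail := by
  cases l <;> rfl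

/-- One column of the addition of two binary numbers; the state consists of the remaining digits
of both numbers, the carry, and the digits of the sum so far, in reverse order. -/
def addStep (s : List Bool × List Bool × Bool × List Bool) :
    List Bool × List Bool × Bool × List Bool :=
  (s.1.tail, s.2.1.tail,
    (s.1.headD false && s.2.1.headD false) || (s.2.2.1 && (s.1.headD false ^^ s.2.1.headD false)),
    (s.2.2.1 ^^ (s.1.headD false ^^ s.2.1.headD false)) :: s.2.2.2)

/-- The sum of two binary numbers; the concatenation of the numbers serves as a clock. -/
def addBits (l m : List Bool) : List Bool :=
  let s := (l.reverse ++ m).foldl (fun s _ => addStep s) (l, m, false, [])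
  (s.2.2.1 :: s.2.2.2).reverse

theorem bitVal_addStep (clock : List Bool) (s : List Bool × List Bool × Bool × List Bool)
    (h₁ : s.1.length ≤ clock.length) (h₂ : s.2.1.length ≤ clock.length) :
    (let s' := clock.foldl (fun s _ => addStep s) s
    bitVal (s'.2.2.1 :: s'.2.2.2).reverse) =
      bitVal s.2.2.2.reverse + 2 ^ s.2.2.2.length * (bitVal s.1 + bitVal s.2.1 + s.2.2.1.toNat) := by
  induction clock generalizing s with
  | nil =>
    obtain ⟨l, m, c, o⟩ := s
    simp only [List.length_nil, nonpos_iff_eq_zero, List.length_eq_zero_iff] at h₁ h₂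
    subst h₁ h₂
    simp [bitVal, bitVal_append]
  | cons _ clock ih =>
    obtain ⟨l, m, c, o⟩ := s
    simp only [List.length_cons] at h₁ h₂
    have := ih (addStep (l, m, c, o)) (by simp [addStep]; omega) (by simp [addStep]; omega)
    simp only [List.foldl_cons] at this ⊢
    rw [this, bitVal_eq_head_tail l, bitVal_eq_head_tail m]
    simp only [addStep, List.reverse_cons, bitVal_append, List.length_reverse, List.length_cons,
      pow_succ, bitVal]
    cases c <;> cases l.headD false <;> cases m.headD false <;> simp <;> ring

theorem bitVal_addBits (l m : List Bool) : bitVal (addBits l m) = bitVal l + bitVal m := by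
  have := bitVal_addStep (l.reverse ++ m) (l, m, false, []) (by simp) (by simp)
  simpa [addBits, bitVal] using this

theorem length_addStep {β : Type*} (clock : List β) (s : List Bool × List Bool × Bool × List Bool) :
    (clock.foldl (fun s _ => addStep s) s).2.2.2.length = s.2.2.2.length + clock.length := by
  induction clock generalizing s with
  | nil => simp
  | cons _ clock ih =>
    rw [List.foldl_cons, ih]
    simp only [addStep, List.length_cons]
    omega

theorem length_addBits (l m : List Bool) : (addBits l m).length = l.length + m.length + 1 := by
  simp only [addBits, List.length_reverse, List.length_cons, length_addStep, List.length_append,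
    List.length_nil]
  omega

/-- One digit of a multiplication by Horner's scheme. -/
def mulStep (m acc : List Bool) (b : Bool) : List Bool :=
  if b then addBits (false :: acc) m else false :: acc

/-- The product of two binary numbers. -/
def mulBits (l m : List Bool) : List Bool := l.reverse.foldl (mulStep m) []

theorem bitVal_mulBits (l m : List Bool) : bitVal (mulBits l m) = bitVal l * bitVal m := by
  induction l with
  | nil => simp [mulBits, bitVal]
  | cons b l ih =>
    have h : mulBits (b :: l) m = mulStep m (mulBits l m) b := by simp [mulBits]
    rw [h, bitVal, mulStep]
    cases b
    · simp [bitVal, ih, mul_assoc]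
    · simp [bitVal_addBits, bitVal, ih]; ring

theorem length_foldl_mulStep (m l acc : List Bool) :
    (l.foldl (mulStep m) acc).length ≤ acc.length + l.length * (m.length + 2) := by
  induction l generalizing acc with
  | nil => simp
  | cons b l ih =>
    refine (ih _).trans ?_
    have : (mulStep m acc b).length ≤ acc.length + (m.length + 2) := by
      unfold mulStep
      split
      · simp [length_addBits]; omega
      · simp
    simp only [List.length_cons]
    nlinarith

/-- One column of the comparison of two binary numbers; the state consists of the remaining digits
of both numbers and the result of the comparison so far. -/
def leStep (s : List Bool × List Bool × Bool) : List Bool × List Bool × Bool :=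
  (s.1.tail, s.2.1.tail, if s.1.headD false ^^ s.2.1.headD false then s.2.1.headD false else s.2.2)

/-- The comparison of two binary numbers, from the least significant digit on; the concatenation of
the numbers serves as a clock. -/
def leBits (l m : List Bool) : Bool :=
  ((l.reverse ++ m).foldl (fun s _ => leStep s) (l, m, true)).2.2

theorem leStep_spec (clock : List Bool) (s : List Bool × List Bool × Bool)
    (h₁ : s.1.length ≤ clock.length) (h₂ : s.2.1.length ≤ clock.length) :
    (clock.foldl (fun s _ => leStep s) s).2.2 = true ↔
      bitVal s.1 < bitVal s.2.1 ∨ bitVal s.1 = bitVal s.2.1 ∧ s.2.2 = true := by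
  induction clock generalizing s with
  | nil =>
    obtain ⟨l, m, c⟩ := s
    simp only [List.length_nil, nonpos_iff_eq_zero, List.length_eq_zero_iff] at h₁ h₂
    subst h₁ h₂
    simp
  | cons _ clock ih =>
    obtain ⟨l, m, c⟩ := s
    simp only [List.length_cons] at h₁ h₂
    rw [List.foldl_cons, ih (leStep (l, m, c)) (by simp [leStep]; omega) (by simp [leStep]; omega)]
    simp only
    rw [bitVal_eq_head_tail l, bitVal_eq_head_tail m]
    simp only [leStep]
    cases c <;> cases l.headD false <;> cases m.headD false <;> simp <;> omega

theorem leBits_iff (l m : List Bool) : leBits l m = true ↔ bitVal l ≤ bitVal m := by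
  rw [leBits, leStep_spec _ _ (by simp) (by simp)]
  simp [le_iff_lt_or_eq]

namespace Computes

variable {α : Type*} {D : α → Prop} {M N : α → ℕ} {a b d : α → Data} {p q : α → Bool}

theorem bool_ite (hp : Computes D M N a fun x => .ofBool (p x))
    (hb : Computes (fun x => D x ∧ p x = true) M N a b)
    (hd : Computes (fun x => D x ∧ ¬ p x = true) M N a d) :
    Computes D M N a fun x => if p x = true then b x else d x :=
  ite hp (fun x _ => by cases p x <;> simp [Data.ofBool]) hb hd

theorem boolOp (f : Bool → Bool → Bool) (hp : Computes D M N a fun x => .ofBool (p x))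
    (hq : Computes D M N a fun x => .ofBool (q x)) :
    Computes D M N a fun x => .ofBool (f (p x) (q x)) := by
  have h : ∀ {D' : α → Prop} (c : Bool), (∀ x, D' x → D x) →
      Computes D' M N a fun x => .ofBool (f c (q x)) := by
    intro D' c hD
    refine (bool_ite (hq.mono hD fun _ _ => le_rfl) (const (.ofBool (f c true)))
      (const (.ofBool (f c false)))).congr fun x _ => ?_
    cases q x <;> simp
  refine (bool_ite hp (h true fun _ hx => hx.1) (h false fun _ hx => hx.1)).congr fun x _ => ?_
  cases p x <;> simp

theorem headBit {l : α → List Bool} (h : Computes D M N a fun x => .ofBits (l x)) :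
    Computes D M N a fun x => .ofBool ((l x).headD false) :=
  h.hd.congr fun _ _ => Data.hd_ofBits _

theorem tailBits {l : α → List Bool} (h : Computes D M N a fun x => .ofBits (l x)) :
    Computes D M N a fun x => .ofBits (l x).tail :=
  h.tl.congr fun _ _ => Data.tl_ofBits _

/-- The bits of two numbers one after the other (the first number reversed). -/
theorem bitsClock {N' : List Bool × List Bool → ℕ} (hN : ∀ x, N' x = x.1.length + x.2.length) :
    Computes (fun _ => True) 0 N' (fun x => .cons (.ofBits x.1) (.ofBits x.2))
      (fun x => .ofList ((x.1.reverse ++ x.2).map .ofBool)) := by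
  have := reverseAppend (D := fun _ => True) (M := 0) (N := N')
    (a := fun x : List Bool × List Bool => .cons (.ofBits x.1) (.ofBits x.2))
    (l := fun x => x.1.map .ofBool) (m := fun x => x.2.map .ofBool) X id.fst id.snd
    (by intro x _; simp [hN])
  exact this.congr fun x _ => by simp

theorem computes_addStep : Computes (fun _ => True) 0 0
    (fun s : List Bool × List Bool × Bool × List Bool => .cons (.ofBits s.1) (.cons (.ofBits s.2.1)
      (.cons (.ofBool s.2.2.1) (.ofBits s.2.2.2))))
    (fun s => .cons (.ofBits (addStep s).1) (.cons (.ofBits (addStep s).2.1)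
      (.cons (.ofBool (addStep s).2.2.1) (.ofBits (addStep s).2.2.2)))) := by
  let e : List Bool × List Bool × Bool × List Bool → Data := fun s =>
    .cons (.ofBits s.1) (.cons (.ofBits s.2.1) (.cons (.ofBool s.2.2.1) (.ofBits s.2.2.2)))
  have h₁ : Computes (fun _ => True) 0 0 e fun s => .ofBool (s.1.headD false) := id.fst.headBit
  have h₂ : Computes (fun _ => True) 0 0 e fun s => .ofBool (s.2.1.headD false) :=
    id.snd.fst.headBit
  have hc : Computes (fun _ => True) 0 0 e fun s => .ofBool s.2.2.1 := id.snd.snd.fst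
  have ho : Computes (fun _ => True) 0 0 e fun s => .ofBits s.2.2.2 := id.snd.snd.snd
  exact id.fst.tailBits.pair (id.snd.fst.tailBits.pair
    ((boolOp or (boolOp and h₁ h₂) (boolOp and hc (boolOp xor h₁ h₂))).pair
      ((boolOp xor hc (boolOp xor h₁ h₂)).pair ho)))

theorem computes_addBits : Computes (fun _ => True) 0
    (fun x : List Bool × List Bool => x.1.length + x.2.length)
    (fun x => .cons (.ofBits x.1) (.ofBits x.2)) (fun x => .ofBits (addBits x.1 x.2)) := by
  have h := foldl (α := List Bool × List Bool) (β := fun _ => Bool)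
    (σ := fun _ => List Bool × List Bool × Bool × List Bool)
    (D := fun _ => True) (M := 0) (N := fun x => x.1.length + x.2.length) (M₂ := 0)
    (a := fun x => .cons (.ofBits x.1) (.ofBits x.2))
    (fun _ s => .cons (.ofBits s.1) (.cons (.ofBits s.2.1) (.cons (.ofBool s.2.2.1)
      (.ofBits s.2.2.2)))) (fun _ => .ofBool)
    (fun x => x.1.reverse ++ x.2) (fun x => (x.1, x.2, false, [])) (fun _ s _ => addStep s) X
    (bitsClock fun _ => rfl) (id.fst.pair (id.snd.pair (nil.pair nil)))
    (computes_addStep.call' (fun y : Σ _ : List Bool × List Bool,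
      (List Bool × List Bool × Bool × List Bool) × Bool => y.2.1) id.snd.fst
      fun _ _ => ⟨trivial, le_rfl, Nat.zero_le _⟩)
    (by intro x _; simp)
  have h' := h.snd.snd
  refine (reverse (l := fun x => (List.map Data.ofBool (_ :: _))) (X + 1)
    (h'.fst.pair h'.snd) ?_).congr ?_
  · intro x _
    simp only [List.map_cons, List.length_cons, List.length_map, length_addStep]
    simp
  · intro x _
    rw [← List.map_reverse]
    rfl

theorem computes_mulBits : Computes (fun _ => True) 0
    (fun x : List Bool × List Bool => x.1.length + x.2.length)
    (fun x => .cons (.ofBits x.1) (.ofBits x.2)) (fun x => .ofBits (mulBits x.1 x.2)) := by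
  refine foldl (α := List Bool × List Bool) (β := fun _ => Bool) (σ := fun _ => List Bool)
    (D := fun _ => True) (M := 0) (N := fun x => x.1.length + x.2.length) (M₂ := 0)
    (a := fun x => .cons (.ofBits x.1) (.ofBits x.2)) (fun _ => .ofBits) (fun _ => .ofBool)
    (fun x => x.1.reverse) (fun _ => []) (fun x => mulStep x.2) X ?_ nil ?_ ?_
  · refine (reverse (l := fun x : List Bool × List Bool => x.1.map .ofBool) X id.fst ?_).congr ?_
    · intro x _
      simp
    · intro x _
      simp
  · have h0 : ∀ {D' : (Σ _ : List Bool × List Bool, List Bool × Bool) → Prop},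
        Computes D' (fun _ => 0) (fun y => y.1.1.length + y.1.2.length)
        (fun y => .cons (.cons (.ofBits y.1.1) (.ofBits y.1.2)) (.cons (.ofBits y.2.1)
          (.ofBool y.2.2))) (fun y => .ofBits (false :: y.2.1)) := nil.pair id.snd.fst
    refine (bool_ite (p := fun y : Σ _ : List Bool × List Bool, List Bool × Bool => y.2.2) id.snd.snd
      (computes_addBits.call (fun y : Σ _ : List Bool × List Bool, List Bool × Bool =>
        (false :: y.2.1, y.1.2)) (X * (X + 2) + X + 1)
        (h0.pair id.fst.snd) ?_) h0).congr ?_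
    · rintro ⟨⟨l, m⟩, acc, b⟩ ⟨⟨-, pre, post, hl, hacc⟩, -⟩
      refine ⟨trivial, by simp, ?_⟩
      have h1 := length_foldl_mulStep m pre []
      have h2 := congrArg List.length hl
      simp only [List.length_nil, List.length_append, List.length_cons, List.length_reverse]
        at h1 h2 hacc ⊢
      rw [← hacc] at h1
      simp only [eval_add, eval_mul, eval_X, eval_ofNat, eval_one]
      have h3 : pre.length * (m.length + 2) ≤
        (l.length + m.length) * (l.length + m.length + 2) := Nat.mul_le_mul (by omega) (by omega)
      omega
    · rintro ⟨⟨l, m⟩, acc, b⟩ _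
      cases b <;> rfl
  · intro x _
    simp

theorem computes_leStep : Computes (fun _ => True) 0 0
    (fun s : List Bool × List Bool × Bool => .cons (.ofBits s.1) (.cons (.ofBits s.2.1)
      (.ofBool s.2.2)))
    (fun s => .cons (.ofBits (leStep s).1) (.cons (.ofBits (leStep s).2.1)
      (.ofBool (leStep s).2.2))) := by
  let e : List Bool × List Bool × Bool → Data := fun s =>
    .cons (.ofBits s.1) (.cons (.ofBits s.2.1) (.ofBool s.2.2))
  have h₁ : ∀ {D : _ → Prop}, Computes D 0 0 e fun s => .ofBool (s.1.headD false) :=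
    id.fst.headBit
  have h₂ : ∀ {D : _ → Prop}, Computes D 0 0 e fun s => .ofBool (s.2.1.headD false) :=
    id.snd.fst.headBit
  have hc : ∀ {D : _ → Prop}, Computes D 0 0 e fun s => .ofBool s.2.2 := id.snd.snd
  exact id.fst.tailBits.pair (id.snd.fst.tailBits.pair
    ((bool_ite (boolOp xor h₁ h₂) h₂ hc).congr fun _ _ => (apply_ite Data.ofBool _ _ _).symm))

theorem computes_leBits : Computes (fun _ => True) 0
    (fun x : List Bool × List Bool => x.1.length + x.2.length)
    (fun x => .cons (.ofBits x.1) (.ofBits x.2)) (fun x => .ofBool (leBits x.1 x.2)) := by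
  have h := foldl (α := List Bool × List Bool) (β := fun _ => Bool)
    (σ := fun _ => List Bool × List Bool × Bool)
    (D := fun _ => True) (M := 0) (N := fun x => x.1.length + x.2.length) (M₂ := 0)
    (a := fun x => .cons (.ofBits x.1) (.ofBits x.2))
    (fun _ s => .cons (.ofBits s.1) (.cons (.ofBits s.2.1) (.ofBool s.2.2))) (fun _ => .ofBool)
    (fun x => x.1.reverse ++ x.2) (fun x => (x.1, x.2, true)) (fun _ s _ => leStep s) X
    (bitsClock fun _ => rfl) (id.fst.pair (id.snd.pair (const _)))
    (computes_leStep.call' (fun y : Σ _ : List Bool × List Bool,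
      (List Bool × List Bool × Bool) × Bool => y.2.1) id.snd.fst
      fun _ _ => ⟨trivial, le_rfl, Nat.zero_le _⟩)
    (by intro x _; simp)
  exact h.snd.snd

/-- Weights are compared by cross multiplication. -/
theorem computes_weightLE : Computes (fun _ => True) 0
    (fun x : ℚ≥0 × ℚ≥0 => x.1.num.bits.length + x.1.den.bits.length +
      (x.2.num.bits.length + x.2.den.bits.length))
    (fun x => .cons (.ofWeight x.1) (.ofWeight x.2)) (fun x => .ofBool (x.1 ≤ x.2)) := by
  have h₁ := computes_mulBits.call (D' := fun _ => True) (M' := 0)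
    (N' := fun x : ℚ≥0 × ℚ≥0 => x.1.num.bits.length + x.1.den.bits.length +
      (x.2.num.bits.length + x.2.den.bits.length))
    (a' := fun x : ℚ≥0 × ℚ≥0 => .cons (.ofWeight x.1) (.ofWeight x.2))
    (fun x => (x.1.num.bits, x.2.den.bits)) (X + 1) (id.fst.fst.pair id.snd.snd)
    (by intro x _; refine ⟨trivial, by simp, by simp; omega⟩)
  have h₂ := computes_mulBits.call (D' := fun _ => True) (M' := 0)
    (N' := fun x : ℚ≥0 × ℚ≥0 => x.1.num.bits.length + x.1.den.bits.length +
      (x.2.num.bits.length + x.2.den.bits.length))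
    (a' := fun x : ℚ≥0 × ℚ≥0 => .cons (.ofWeight x.1) (.ofWeight x.2))
    (fun x => (x.2.num.bits, x.1.den.bits)) (X + 1) (id.snd.fst.pair id.fst.snd)
    (by intro x _; refine ⟨trivial, by simp, by simp; omega⟩)
  refine (computes_leBits.call (fun x : ℚ≥0 × ℚ≥0 => (mulBits x.1.num.bits x.2.den.bits,
    mulBits x.2.num.bits x.1.den.bits)) (2 * (X * (X + 2)) + 1) (h₁.pair h₂) ?_).congr ?_
  · intro x _
    refine ⟨trivial, by simp, ?_⟩
    have h₁ := length_foldl_mulStep x.2.den.bits x.1.num.bits.reverse []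
    have h₂ := length_foldl_mulStep x.1.den.bits x.2.num.bits.reverse []
    simp only [List.length_nil, List.length_reverse] at h₁ h₂
    simp only [mulBits, eval_add, eval_mul, eval_X, eval_ofNat, eval_one]
    set n := x.1.num.bits.length + x.1.den.bits.length +
      (x.2.num.bits.length + x.2.den.bits.length) with hn
    have h₃ : x.1.num.bits.length * (x.2.den.bits.length + 2) ≤ n * (n + 2) :=
      Nat.mul_le_mul (by omega) (by omega)
    have h₄ : x.2.num.bits.length * (x.1.den.bits.length + 2) ≤ n * (n + 2) :=
      Nat.mul_le_mul (by omega) (by omega)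
    omega
  · intro x _
    congr 1
    rw [Bool.eq_iff_iff, leBits_iff, bitVal_mulBits, bitVal_mulBits]
    simp [bitVal_bits, NNRat.le_def]

end Computes

/-! ### Sizes of trees -/

/-- The height of a tree. Unlike the number of nodes, it grows by at most one in each step. -/
def Data.height : Data → ℕ
  | nil => 0
  | cons a b => max a.height b.height + 1

theorem Runs.height_le {P : Prog} {x y : Data} {t : ℕ} (h : Runs P x y t) :
    y.height ≤ x.height + t := by
  induction h with
  | nil | skip => simp [Data.height]
  | hd x | tl x => cases x <;> simp [Data.height, Data.hd, Data.tl]; omega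
  | pair => simp only [Data.height]; omega
  | _ => omega

theorem Data.length_le_height (l : List Data) : l.length ≤ (Data.ofList l).height := by
  induction l with
  | nil => simp
  | cons a l ih => simp only [Data.ofList, Data.height, List.length_cons]; omega

theorem Data.height_ofList_le {l : List Data} {m : ℕ} (h : ∀ d ∈ l, d.height ≤ m) :
    (Data.ofList l).height ≤ m + l.length := by
  induction l with
  | nil => simp [Data.ofList, Data.height]
  | cons a l ih =>
    have := ih fun d hd => h d (List.mem_cons_of_mem _ hd)
    have := h a List.mem_cons_self
    simp only [Data.ofList, Data.height, List.length_cons]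
    omega

theorem Data.height_ofUnary_le (m : ℕ) : (Data.ofUnary m).height ≤ m := by
  have := Data.height_ofList_le (l := List.replicate m .nil) (m := 0)
    (by intro d hd; rw [List.eq_of_mem_replicate hd]; rfl)
  simpa [Data.ofUnary] using this

theorem Data.height_ofBits_le (l : List Bool) : (Data.ofBits l).height ≤ l.length + 1 := by
  have := Data.height_ofList_le (l := l.map .ofBool) (m := 1) (by
    intro d hd
    obtain ⟨b, _, rfl⟩ := List.mem_map.1 hd
    cases b <;> simp [Data.ofBool, Data.height])
  rw [Data.ofBits]
  simp only [List.length_map] at this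
  omega

theorem Data.height_ofPlan_le {k n : ℕ} (π : Fin k → Fin n) : (Data.ofPlan π).height ≤ n + k := by
  have := Data.height_ofList_le (l := List.ofFn fun s => Data.ofUnary (π s : ℕ)) (m := n) (by
    intro d hd
    obtain ⟨s, rfl⟩ := (List.mem_ofFn' _ _).1 hd
    exact (Data.height_ofUnary_le _).trans (π s).2.le)
  simpa [Data.ofPlan] using this

theorem Data.length_bits_le_height (q : ℚ≥0) :
    q.num.bits.length + q.den.bits.length ≤ 2 * (Data.ofWeight q).height := by
  have h₁ := Data.length_le_height (q.num.bits.map .ofBool)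
  have h₂ := Data.length_le_height (q.den.bits.map .ofBool)
  simp only [List.length_map] at h₁ h₂
  simp only [Data.ofWeight, Data.ofBits, Data.height]
  omega

namespace InstanceClass

variable {I : Type*} (F : InstanceClass I)

theorem height_input_le (i : I) : (F.input i).height ≤ F.size i + 3 := by
  have h₁ := Data.height_ofUnary_le (F.k i)
  have h₂ := Data.height_ofUnary_le (F.n i)
  have h₃ := Data.height_ofBits_le (F.desc i)
  simp only [input, size, Data.height]
  omega

/-- Two plans can be compared by a weight that can be computed. -/
theorem PolyTimeComputable.computes_le {F : InstanceClass I}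
    {w : ∀ i, (Fin (F.k i) → Fin (F.n i)) → ℚ≥0} (h : F.PolyTimeComputable w) :
    Computes (fun _ => True) 0
      (fun y : Σ i, (Fin (F.k i) → Fin (F.n i)) × (Fin (F.k i) → Fin (F.n i)) => F.size y.1)
      (fun y => .cons (F.input y.1) (.cons (.ofPlan y.2.1) (.ofPlan y.2.2)))
      (fun y => .ofBool (w y.1 y.2.1 ≤ w y.1 y.2.2)) := by
  obtain ⟨Q, q, hQ⟩ := h
  have hw : Computes (fun _ => True) 0 (fun y : Σ i, Fin (F.k i) → Fin (F.n i) => F.size y.1)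
      (fun y => .cons (F.input y.1) (.ofPlan y.2)) (fun y => .ofWeight (w y.1 y.2)) :=
    ⟨Q, q, fun y _ => by simpa using hQ y.1 y.2⟩
  have hlen : ∀ i π, (w i π).num.bits.length + (w i π).den.bits.length ≤
      2 * (F.size i + F.size i + 4 + q.eval (F.size i)) := by
    intro i π
    obtain ⟨t, ht, ht'⟩ := hQ i π
    have h₁ := ht.height_le
    have h₂ := Data.length_bits_le_height (w i π)
    have h₃ := F.height_input_le i
    have h₄ := Data.height_ofPlan_le π
    have h₅ : F.n i + F.k i ≤ F.size i := by simp only [size]; omega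
    simp only [Data.height] at h₁
    omega
  refine Computes.computes_weightLE.call
    (fun y : Σ i, (Fin (F.k i) → Fin (F.n i)) × (Fin (F.k i) → Fin (F.n i)) =>
      (w y.1 y.2.1, w y.1 y.2.2)) (4 * (X + X + 4 + q))
    ((hw.call' (fun y : Σ i, (Fin (F.k i) → Fin (F.n i)) × (Fin (F.k i) → Fin (F.n i)) =>
        (⟨y.1, y.2.1⟩ : Σ i, Fin (F.k i) → Fin (F.n i))) (Computes.id.fst.pair Computes.id.snd.fst) ?_).pair
      (hw.call' (fun y : Σ i, (Fin (F.k i) → Fin (F.n i)) × (Fin (F.k i) → Fin (F.n i)) =>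
        (⟨y.1, y.2.2⟩ : Σ i, Fin (F.k i) → Fin (F.n i))) (Computes.id.fst.pair Computes.id.snd.snd) ?_)) ?_
  · exact fun y _ => ⟨trivial, le_rfl, le_rfl⟩
  · exact fun y _ => ⟨trivial, le_rfl, le_rfl⟩
  · intro y _
    have h₁ := hlen y.1 y.2.1
    have h₂ := hlen y.1 y.2.2
    refine ⟨trivial, ?_, ?_⟩
    · simp; omega
    · simp only [eval_mul, eval_add, eval_X, eval_ofNat]
      omega

end InstanceClass

/-! ### Enumeration of tuples -/

/-- Lists of numbers in unary as trees. -/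
def Data.ofNats (l : List ℕ) : Data := .ofList (l.map .ofUnary)

theorem foldl_cons_map {β γ : Type*} (f : β → γ) (l : List β) (s : List γ) :
    l.foldl (fun s b => f b :: s) s = (l.map f).reverse ++ s := by
  induction l generalizing s with
  | nil => simp
  | cons b l ih => simp [ih]

/-- All tuples of the form `u :: l` with `u ∈ us` and `l ∈ L`. -/
def consAll (us : List ℕ) (L : List (List ℕ)) : List (List ℕ) :=
  us.foldl (fun acc u => L.foldl (fun acc l => (u :: l) :: acc) acc) []

theorem mem_consAll {us : List ℕ} {L : List (List ℕ)} {t : List ℕ} :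
    t ∈ consAll us L ↔ ∃ u ∈ us, ∃ l ∈ L, u :: l = t := by
  simp [consAll]

theorem length_consAll (us : List ℕ) (L : List (List ℕ)) :
    (consAll us L).length = us.length * L.length := by
  have : ∀ acc : List (List ℕ), (us.foldl (fun acc u => L.foldl (fun acc l => (u :: l) :: acc) acc)
      acc).length = us.length * L.length + acc.length := by
    induction us with
    | nil => simp
    | cons u us ih =>
      intro acc
      rw [List.foldl_cons, ih, foldl_cons_map]
      simp only [List.length_append, List.length_reverse, List.length_map, List.length_cons]
      ring
  simpa [consAll] using this []

/-- All tuples of length `k` with entries in `us`; only the length of `clock` matters. -/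
def tuples {β : Type*} (us : List ℕ) (clock : List β) : List (List ℕ) :=
  clock.foldl (fun L _ => consAll us L) [[]]

theorem mem_tuples {β : Type*} {us : List ℕ} {clock : List β} {t : List ℕ} :
    t ∈ tuples us clock ↔ t.length = clock.length ∧ ∀ u ∈ t, u ∈ us := by
  induction clock using List.reverseRecOn generalizing t with
  | nil => simp +contextual [tuples]
  | append_singleton clock b ih =>
    have h : tuples us (clock ++ [b]) = consAll us (tuples us clock) := by simp [tuples]
    rw [h, mem_consAll]
    simp only [ih]
    constructor
    · rintro ⟨u, hu, l, ⟨hl, hl'⟩, rfl⟩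
      simp_all
    · rintro ⟨h1, h2⟩
      cases t with
      | nil => simp at h1
      | cons u t => exact ⟨u, h2 u (by simp), t, ⟨by simpa using h1, fun v hv => h2 v (by simp [hv])⟩, rfl⟩

theorem length_tuples {β : Type*} (us : List ℕ) (clock : List β) :
    (tuples us clock).length = us.length ^ clock.length := by
  induction clock using List.reverseRecOn with
  | nil => simp [tuples]
  | append_singleton clock b ih =>
    have h : tuples us (clock ++ [b]) = consAll us (tuples us clock) := by simp [tuples]
    rw [h, length_consAll, ih]
    simp [pow_succ, mul_comm]

namespace Computes

theorem drop : Computes (fun _ => True) 0 (fun x : ℕ × List Data => x.1)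
    (fun x => .cons (.ofUnary x.1) (.ofList x.2)) (fun x => .ofList (x.2.drop x.1)) := by
  have h := foldl (α := ℕ × List Data) (β := fun _ => Data) (σ := fun _ => List Data)
    (D := fun _ => True) (M := 0) (N := fun x => x.1) (M₂ := 0)
    (a := fun x => .cons (.ofUnary x.1) (.ofList x.2)) (fun _ => .ofList) (fun _ d => d)
    (fun x => List.replicate x.1 .nil) (fun x => x.2) (fun _ s _ => s.tail) X
    (Computes.congr (b := fun x => .ofUnary x.1) id.fst fun x _ => by simp [Data.ofUnary]) id.snd
    (id.snd.fst.tl.congr (by rintro ⟨x, _ | ⟨a, s⟩, b⟩ _ <;> rfl))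
    (by intro x _; simp)
  refine h.congr fun x _ => congrArg _ ?_
  obtain ⟨m, l⟩ := x
  simp only
  induction m generalizing l with
  | zero => simp
  | succ m ih => simp [List.replicate_succ, ih]

/-- The names of all users, from the number of users. -/
theorem range : Computes (fun _ => True) 0 (fun m : ℕ => m) (fun m => .ofUnary m)
    (fun m => .ofNats (List.range m)) := by
  have h := foldl (α := ℕ) (β := fun _ => Unit) (σ := fun _ => ℕ × List ℕ)
    (D := fun _ => True) (M := 0) (N := fun m => m) (M₂ := 0) (a := fun m => .ofUnary m)
    (fun _ s => .cons (.ofUnary s.1) (.ofNats s.2)) (fun _ _ => .nil)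
    (fun m => List.replicate m ()) (fun _ => (0, [])) (fun _ s _ => (s.1 + 1, s.1 :: s.2)) X
    (id.congr fun x _ => by simp [Data.ofUnary]) (nil.pair nil)
    ((nil.pair id.snd.fst.fst).pair (id.snd.fst.fst.pair id.snd.fst.snd))
    (by intro x _; simp)
  have hfold : ∀ m, (List.replicate m ()).foldl (fun (s : ℕ × List ℕ) _ => (s.1 + 1, s.1 :: s.2))
      (0, []) = (m, (List.range m).reverse) := by
    intro m
    induction m with
    | zero => rfl
    | succ m ih => rw [List.replicate_succ', List.foldl_append, ih]; simp [List.range_succ]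
  refine (reverse (l := fun m => ((List.range m).reverse.map .ofUnary)) X
    (h.snd.congr fun m _ => ?_) ?_).congr fun m _ => ?_
  · rw [hfold]
    rfl
  · intro m _
    simp
  · simp [Data.ofNats, ← List.map_reverse]

theorem computes_consAll : Computes (fun _ => True)
    (fun x : List ℕ × List (List ℕ) => x.2.length) (fun x => x.1.length)
    (fun x => .cons (.ofNats x.1) (.ofList (x.2.map .ofNats)))
    (fun x => .ofList ((consAll x.1 x.2).map .ofNats)) := by
  have h₁ := foldl (α := List (List ℕ) × List (List ℕ) × ℕ) (β := fun _ => List ℕ)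
    (σ := fun _ => List (List ℕ)) (D := fun _ => True) (M := fun x => x.1.length) (N := 0) (M₂ := 0)
    (a := fun x => .cons (.ofList (x.1.map .ofNats)) (.cons (.ofList (x.2.1.map .ofNats))
      (.ofUnary x.2.2))) (fun _ s => .ofList (s.map .ofNats)) (fun _ => .ofNats)
    (fun x => x.1) (fun x => x.2.1) (fun x s l => (x.2.2 :: l) :: s) 1 id.fst id.snd.fst
    ((id.fst.snd.snd.pair id.snd.snd).pair id.snd.fst) (by intro x _; simp)
  exact foldl (α := List ℕ × List (List ℕ)) (β := fun _ => ℕ) (σ := fun _ => List (List ℕ))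
    (D := fun _ => True) (M := fun x => x.2.length) (N := fun x => x.1.length)
    (M₂ := fun x => x.2.length)
    (a := fun x => .cons (.ofNats x.1) (.ofList (x.2.map .ofNats)))
    (fun _ s => .ofList (s.map .ofNats)) (fun _ => .ofUnary) (fun x => x.1) (fun _ => [])
    (fun x acc u => x.2.foldl (fun acc l => (u :: l) :: acc) acc) X id.fst nil
    (h₁.call' (fun y : Σ _ : List ℕ × List (List ℕ), List (List ℕ) × ℕ => (y.1.2, y.2.1, y.2.2))
      (id.fst.snd.pair id.snd) fun _ _ => ⟨trivial, le_rfl, Nat.zero_le _⟩)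
    (by intro x _; simp [mul_comm])

/-- All tuples of length `k` over an alphabet of size `m`, in time `m ^ k` up to a polynomial. -/
theorem computes_tuples : Computes (fun _ => True) (fun x : ℕ × ℕ => x.2 ^ x.1) (fun x => x.1 + x.2)
    (fun x => .cons (.ofUnary x.1) (.ofUnary x.2))
    (fun x => .ofList ((tuples (List.range x.2) (List.replicate x.1 ())).map .ofNats)) := by
  have h := foldl (α := ℕ × ℕ) (β := fun _ => Unit) (σ := fun _ => List (List ℕ))
    (D := fun _ => True) (M := fun x => x.2 ^ x.1) (N := fun x => x.1 + x.2)
    (M₂ := fun x => x.2 ^ x.1 + 1)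
    (a := fun x => .cons (.ofUnary x.1) (.ofNats (List.range x.2)))
    (fun _ s => .ofList (s.map .ofNats)) (fun _ _ => .nil) (fun x => List.replicate x.1 ())
    (fun _ => [[]]) (fun x L _ => consAll (List.range x.2) L) (2 * X)
    (Computes.congr (b := fun x => .ofUnary x.1) id.fst fun x _ => by simp [Data.ofUnary])
    (nil.pair nil)
    (computes_consAll.call' (fun y : Σ _ : ℕ × ℕ, List (List ℕ) × Unit => (List.range y.1.2, y.2.1))
      (id.fst.snd.pair id.snd.fst) ?_) ?_
  · refine (id.fst.pair (range.call' (fun x : ℕ × ℕ => x.2) id.snd ?_)).comp h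
    exact fun x _ => ⟨trivial, Nat.zero_le _, by simp⟩
  · rintro ⟨⟨k, m⟩, L, u⟩ ⟨-, pre, post, hl, hL⟩
    refine ⟨trivial, ?_, by simp⟩
    have h₁ := congrArg List.length hl
    simp only at hL
    have h₂ : L = tuples (List.range m) pre := hL
    simp only [List.length_replicate, List.length_append, List.length_cons] at h₁
    simp only [h₂, length_tuples, List.length_range]
    rcases Nat.eq_zero_or_pos m with rfl | hm
    · have : (0 : ℕ) ^ pre.length ≤ 1 := by
        rcases Nat.eq_zero_or_pos pre.length with h | h <;> simp [h, Nat.pos_iff_ne_zero.1]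
      exact this.trans (Nat.le_add_left _ _)
    · exact (Nat.pow_le_pow_right hm (by omega)).trans (Nat.le_succ _)
  · rintro ⟨k, m⟩ _
    simp only [List.length_replicate, eval_mul, eval_X, eval_ofNat]
    nlinarith [Nat.zero_le (m ^ k * k), Nat.zero_le (m ^ k * m)]

end Computes

/-! ### Merge sort -/

section MergeSort

variable {β : Type*} (le : β → β → Bool)

/-- One step of merging two lists; the third list is the result so far, in reverse order. -/
def mergeStep : List β × List β × List β → List β × List β × List β
  | ([], [], o) => ([], [], o)
  | ([], b :: m, o) => ([], m, b :: o)
  | (a :: l, [], o) => (l, [], a :: o)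
  | (a :: l, b :: m, o) => if le a b then (l, b :: m, a :: o) else (a :: l, m, b :: o)

/-- Whether the next element is taken from the first list. -/
def takesLeft : List β → List β → Bool
  | [], _ => false
  | _ :: _, [] => true
  | a :: _, b :: _ => le a b

/-- Merging the lists of a family in pairs; the second family is the result so far. -/
def mergePairs : List (List β) → List (List β) → List (List β)
  | [], o => o
  | [a], o => List.merge a [] le :: o
  | a :: b :: T, o => mergePairs T (List.merge a b le :: o)

theorem length_mergePairs (T o : List (List β)) :
    (mergePairs le T o).length = (T.length + 1) / 2 + o.length := by
  fun_induction mergePairs le T o with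
  | case1 o => simp
  | case2 a o => simp; omega
  | case3 a b T o ih => rw [ih]; simp; omega

theorem flatten_mergePairs (T o : List (List β)) :
    (mergePairs le T o).flatten.Perm (T.flatten ++ o.flatten) := by
  fun_induction mergePairs le T o with
  | case1 o => simp
  | case2 a o => simp
  | case3 a b T o ih =>
    refine ih.trans ?_
    simp only [List.flatten_cons]
    refine List.perm_append_comm_assoc _ _ _ |>.trans ?_
    refine ((List.merge_perm_append (le := le)).append_right _).trans ?_
    simp

theorem pairwise_mergePairs (htrans : ∀ a b c, le a b = true → le b c = true → le a c = true)
    (htotal : ∀ a b, (le a b || le b a) = true) (T o : List (List β))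
    (hT : ∀ l ∈ T, l.Pairwise fun a b => le a b = true)
    (ho : ∀ l ∈ o, l.Pairwise fun a b => le a b = true) :
    ∀ l ∈ mergePairs le T o, l.Pairwise fun a b => le a b = true := by
  fun_induction mergePairs le T o with
  | case1 o => exact ho
  | case2 a o => simpa using ⟨hT a (by simp), ho⟩
  | case3 a b T o ih =>
    refine ih (fun l hl => hT l (by simp [hl])) ?_
    intro l hl
    rcases List.mem_cons.1 hl with rfl | hl
    · exact List.pairwise_merge htrans htotal _ _ (hT a (by simp)) (hT b (by simp))
    · exact ho l hl

/-- Merging in pairs until one list is left. -/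
def mergeAll (T : List (List β)) : List (List β) :=
  if 2 ≤ T.length then mergeAll (mergePairs le T []) else T
termination_by T.length
decreasing_by simp [length_mergePairs]; omega

/-- Bottom-up merge sort. -/
def sortBy (l : List β) : List β := (mergeAll le (l.map fun b => [b])).headD []

theorem sortBy_perm (l : List β) : (sortBy le l).Perm l := by
  have h : ∀ T : List (List β), ((mergeAll le T).headD []).Perm T.flatten := by
    intro T
    fun_induction mergeAll le T with
    | case1 T _ ih => exact ih.trans (by simpa using flatten_mergePairs le T [])
    | case2 T h =>
      match T with
      | [] => simp
      | [a] => simp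
      | _ :: _ :: _ => simp at h
  refine (h _).trans ?_
  rw [← List.flatMap_def]
  simp

theorem pairwise_sortBy (htrans : ∀ a b c, le a b = true → le b c = true → le a c = true)
    (htotal : ∀ a b, (le a b || le b a) = true) (l : List β) :
    (sortBy le l).Pairwise fun a b => le a b = true := by
  have h : ∀ T : List (List β), (∀ l ∈ T, l.Pairwise fun a b => le a b = true) →
      ((mergeAll le T).headD []).Pairwise fun a b => le a b = true := by
    intro T
    fun_induction mergeAll le T with
    | case1 T _ ih =>
      exact fun hT => ih (pairwise_mergePairs le htrans htotal T [] hT (by simp))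
    | case2 T h =>
      intro hT
      match T with
      | [] => simp
      | a :: _ => exact hT a (by simp)
  refine h _ ?_
  simp

/-- One step of the sweep over a sorted list that keeps an element unless the last one that has
been kept is at least as good. -/
def sweepStep (better : β → β → Bool) (o : List β) (x : β) : List β :=
  match o with
  | [] => [x]
  | y :: o => if better y x then y :: o else x :: y :: o

end MergeSort

namespace Computes

variable {I : Type*} {β : I → Type*} {inp : I → Data} {enc : ∀ i, β i → Data} {size : I → ℕ}
  {le : ∀ i, β i → β i → Bool}

theorem computes_merge
    (hle : Computes (fun _ => True) 0 (fun y : Σ i, β i × β i => size y.1)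
      (fun y => .cons (inp y.1) (.cons (enc y.1 y.2.1) (enc y.1 y.2.2)))
      (fun y => .ofBool (le y.1 y.2.1 y.2.2))) :
    Computes (fun _ => True) (fun y : Σ i, List (β i) × List (β i) => y.2.1.length + y.2.2.length)
      (fun y => size y.1)
      (fun y => .cons (inp y.1) (.cons (.ofList (y.2.1.map (enc y.1)))
        (.ofList (y.2.2.map (enc y.1)))))
      (fun y => .ofList ((List.merge y.2.1 y.2.2 (le y.1)).map (enc y.1))) := by
  let e : (Σ i, List (β i) × List (β i) × List (β i)) → Data := fun z =>
    .cons (inp z.1) (.cons (.ofList (z.2.1.map (enc z.1))) (.cons (.ofList (z.2.2.1.map (enc z.1)))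
      (.ofList (z.2.2.2.map (enc z.1)))))
  let N : (Σ i, List (β i) × List (β i) × List (β i)) → ℕ := fun z => size z.1
  have hl : ∀ {D : _ → Prop}, Computes D 0 N e fun z => .ofList (z.2.1.map (enc z.1)) := id.snd.fst
  have hm : ∀ {D : _ → Prop}, Computes D 0 N e fun z => .ofList (z.2.2.1.map (enc z.1)) :=
    id.snd.snd.fst
  have ho : ∀ {D : _ → Prop}, Computes D 0 N e fun z => .ofList (z.2.2.2.map (enc z.1)) :=
    id.snd.snd.snd
  have hleft : ∀ {D : _ → Prop},
      Computes D 0 N e fun z => .ofBool (takesLeft (le z.1) z.2.1 z.2.2.1) := by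
    intro D
    classical
    refine (ite (p := fun z => z.2.1 ≠ []) hl ?_ (ite (p := fun z => z.2.2.1 ≠ [])
      (b := fun z => .ofBool (takesLeft (le z.1) z.2.1 z.2.2.1)) hm ?_
      ((id.fst.pair (hl.hd.pair hm.hd)).comp (hle.sub (X + 1) ?_)) (const (.ofBool true)))
      (const (.ofBool false))).congr ?_
    · simp [Data.ofList_eq_nil_iff]
    · simp [Data.ofList_eq_nil_iff]
    · rintro ⟨i, _ | ⟨a, l⟩, _ | ⟨b, m⟩, o⟩ ⟨⟨-, h₁⟩, h₂⟩
      · exact absurd rfl h₂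
      · exact absurd rfl h₁
      · exact absurd rfl h₂
      · exact ⟨⟨i, a, b⟩, trivial, rfl, rfl, by simp, by simp [N]⟩
    · rintro ⟨i, _ | ⟨a, l⟩, _ | ⟨b, m⟩, o⟩ _ <;> simp [takesLeft]
  have hloop : Computes (fun _ => True) (fun z => z.2.1.length + z.2.2.1.length) N e
      (fun z => .cons (inp z.1) (.cons .nil (.cons .nil
        (.ofList (((List.merge z.2.1 z.2.2.1 (le z.1)).reverse ++ z.2.2.2).map (enc z.1)))))) := by
    classical
    refine loop (M := 0)
      (c := fun z => if z.2.1 ≠ [] then .ofList (z.2.1.map (enc z.1))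
        else .ofList (z.2.2.1.map (enc z.1)))
      (fun z => ⟨z.1, mergeStep (le z.1) z.2⟩)
      (ite (p := fun z => z.2.1 ≠ []) hl ?_ hl hm) ?_ ?_ ?_
    · simp [Data.ofList_eq_nil_iff]
    · refine (bool_ite hleft (id.fst.pair (hl.tl.pair (hm.pair (hl.hd.pair ho))))
        (id.fst.pair (hl.pair (hm.tl.pair (hm.hd.pair ho))))).congr ?_
      rintro ⟨i, _ | ⟨a, l⟩, _ | ⟨b, m⟩, o⟩ ⟨_, h⟩
      · simp [Data.ofList] at h
      · rfl
      · rfl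
      · by_cases hab : le i a b = true
        · simp [takesLeft, mergeStep, hab, e, Data.ofList, Data.hd, Data.tl]
        · simp [takesLeft, mergeStep, hab, e, Data.ofList, Data.hd, Data.tl]
    · rintro ⟨i, _ | ⟨a, l⟩, _ | ⟨b, m⟩, o⟩ _ h
      · simp [Data.ofList] at h
      · simp [mergeStep, N, add_comm]
      · simp [mergeStep, N, add_comm]
      · by_cases hab : le i a b = true
        · simp [mergeStep, hab, N]; omega
        · simp [mergeStep, hab, N]; omega
    · rintro ⟨i, _ | ⟨a, l⟩, _ | ⟨b, m⟩, o⟩ _ h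
      · simp [e, Data.ofList]
      · simp [Data.ofList] at h
      · simp [Data.ofList] at h
      · simp [Data.ofList] at h
  have h := hloop.call' (D' := fun _ => True)
    (M' := fun y : Σ i, List (β i) × List (β i) => y.2.1.length + y.2.2.length)
    (N' := fun y => size y.1)
    (fun y => (⟨y.1, y.2.1, y.2.2, []⟩ : Σ i, List (β i) × List (β i) × List (β i)))
    (id.fst.pair (id.snd.fst.pair (id.snd.snd.pair nil))) fun _ _ => ⟨trivial, le_rfl, le_rfl⟩
  refine (reverse (1 : ℕ[X]) h.snd.snd.snd ?_).congr ?_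
  · rintro ⟨i, l, m⟩ _
    simp
  · rintro ⟨i, l, m⟩ _
    simp

theorem hd_ofList_lists {γ : Type*} (f : γ → Data) (T : List (List γ)) :
    (Data.ofList (T.map fun l => .ofList (l.map f))).hd = .ofList ((T.headD []).map f) := by
  cases T <;> rfl

theorem tl_ofList_map {γ : Type*} (f : γ → Data) (T : List γ) :
    (Data.ofList (T.map f)).tl = .ofList (T.tail.map f) := by
  cases T <;> rfl

theorem computes_mergePairs
    (hle : Computes (fun _ => True) 0 (fun y : Σ i, β i × β i => size y.1)
      (fun y => .cons (inp y.1) (.cons (enc y.1 y.2.1) (enc y.1 y.2.2)))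
      (fun y => .ofBool (le y.1 y.2.1 y.2.2))) :
    Computes (fun _ => True)
      (fun y : Σ i, List (List (β i)) => y.2.length + y.2.flatten.length) (fun y => size y.1)
      (fun y => .cons (inp y.1) (.ofList (y.2.map fun l => .ofList (l.map (enc y.1)))))
      (fun y => .ofList ((mergePairs (le y.1) y.2 []).map fun l => .ofList (l.map (enc y.1)))) := by
  let e : (Σ i, List (List (β i)) × List (List (β i))) → Data := fun z =>
    .cons (inp z.1) (.cons (.ofList (z.2.1.map fun l => .ofList (l.map (enc z.1))))
      (.ofList (z.2.2.map fun l => .ofList (l.map (enc z.1)))))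
  have hloop : Computes (fun _ => True) (fun z => z.2.1.length + z.2.1.flatten.length)
      (fun z => size z.1) e
      (fun z => .cons (inp z.1) (.cons .nil
        (.ofList ((mergePairs (le z.1) z.2.1 z.2.2).map fun l => .ofList (l.map (enc z.1)))))) := by
    refine loop (M := fun z => (z.2.1.headD []).length + (z.2.1.tail.headD []).length)
      (c := fun z => .ofList (z.2.1.map fun l => .ofList (l.map (enc z.1))))
      (fun z => ⟨z.1, z.2.1.tail.tail,
        List.merge (z.2.1.headD []) (z.2.1.tail.headD []) (le z.1) :: z.2.2⟩) id.snd.fst ?_ ?_ ?_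
    · refine Computes.pair id.fst (Computes.pair (id.snd.fst.tl.tl.congr ?_)
        (Computes.pair ((computes_merge hle).call'
          (fun z : Σ i, List (List (β i)) × List (List (β i)) =>
            (⟨z.1, z.2.1.headD [], z.2.1.tail.headD []⟩ : Σ i, List (β i) × List (β i)))
          ((id.fst.pair (id.snd.fst.hd.pair id.snd.fst.tl.hd)).congr ?_)
          fun _ _ => ⟨trivial, le_rfl, le_rfl⟩) id.snd.snd))
      · intro z _
        rw [tl_ofList_map, tl_ofList_map]
      · intro z _
        rw [tl_ofList_map, hd_ofList_lists, hd_ofList_lists]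
    · rintro ⟨i, _ | ⟨a, _ | ⟨b, T⟩⟩, o⟩ _ h
      · exact absurd rfl h
      · simp [mergePairs]
      · simp [mergePairs]
        omega
    · rintro ⟨i, T, o⟩ _ h
      have : T = [] := by simpa [Data.ofList_eq_nil_iff] using h
      subst this
      rfl
  exact (hloop.call' (D' := fun _ => True)
    (M' := fun y : Σ i, List (List (β i)) => y.2.length + y.2.flatten.length)
    (N' := fun y => size y.1)
    (fun y => (⟨y.1, y.2, []⟩ : Σ i, List (List (β i)) × List (List (β i))))
    (id.fst.pair (id.snd.pair nil)) fun _ _ => ⟨trivial, le_rfl, le_rfl⟩).snd.snd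

/-- Sorting `K` elements, with a polynomial-time comparison, takes time `K log K` up to a
polynomial. -/
theorem computes_sortBy
    (hle : Computes (fun _ => True) 0 (fun y : Σ i, β i × β i => size y.1)
      (fun y => .cons (inp y.1) (.cons (enc y.1 y.2.1) (enc y.1 y.2.2)))
      (fun y => .ofBool (le y.1 y.2.1 y.2.2))) :
    Computes (fun _ => True)
      (fun y : Σ i, List (β i) => (Nat.clog 2 y.2.length + 1) * (2 * y.2.length + 1))
      (fun y => size y.1) (fun y => .cons (inp y.1) (.ofList (y.2.map (enc y.1))))
      (fun y => .ofList ((sortBy (le y.1) y.2).map (enc y.1))) := by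
  have hloop : Computes (fun _ => True)
      (fun z : Σ i, List (List (β i)) =>
        Nat.clog 2 z.2.length * (z.2.length + z.2.flatten.length + 1)) (fun z => size z.1)
      (fun z => .cons (inp z.1) (.ofList (z.2.map fun l => .ofList (l.map (enc z.1)))))
      (fun z => .cons (inp z.1)
        (.ofList ((mergeAll (le z.1) z.2).map fun l => .ofList (l.map (enc z.1))))) := by
    refine loop (M := fun z => z.2.length + z.2.flatten.length)
      (c := fun z => (Data.ofList (z.2.map fun l => .ofList (l.map (enc z.1)))).tl)
      (fun z => ⟨z.1, mergePairs (le z.1) z.2 []⟩) id.snd.tl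
      (id.fst.pair ((computes_mergePairs hle).mono (fun _ _ => trivial) fun _ _ => le_rfl)) ?_ ?_
    · rintro ⟨i, T⟩ _ h
      simp only [tl_ofList_map, ne_eq, Data.ofList_eq_nil_iff, List.map_eq_nil_iff] at h
      have hT : 2 ≤ T.length := by
        match T with
        | [] => simp at h
        | [_] => simp at h
        | _ :: _ :: _ => simp
      refine ⟨trivial, le_rfl, ?_, ?_⟩
      · have h₁ := (flatten_mergePairs (le i) T []).length_eq
        simp only [List.flatten_nil, List.append_nil] at h₁
        have h₂ := Nat.clog_of_two_le (b := 2) one_lt_two hT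
        simp only [h₁, length_mergePairs, List.length_nil, add_zero, h₂]
        have h₃ : (T.length + 1) / 2 ≤ T.length := by omega
        have h₄ : (T.length + 2 - 1) / 2 = (T.length + 1) / 2 := by omega
        rw [h₄]
        nlinarith [Nat.mul_le_mul_left (Nat.clog 2 ((T.length + 1) / 2)) h₃]
      · conv_rhs => rw [mergeAll, if_pos hT]
    · rintro ⟨i, T⟩ _ h
      simp only [tl_ofList_map, Data.ofList_eq_nil_iff, List.map_eq_nil_iff] at h
      have hT : ¬ 2 ≤ T.length := by
        match T with
        | [] => simp
        | [_] => simp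
        | _ :: _ :: _ => simp at h
      rw [mergeAll, if_neg hT]
  have hsing : Computes (fun _ => True)
      (fun y : Σ i, List (β i) => (Nat.clog 2 y.2.length + 1) * (2 * y.2.length + 1))
      (fun y => size y.1) (fun y => .cons (inp y.1) (.ofList (y.2.map (enc y.1))))
      (fun y => .ofList ((y.2.map fun b => [b]).map fun l => .ofList (l.map (enc y.1)))) := by
    refine Computes.map (M₂ := 0) (β := fun y : Σ i, List (β i) => β y.1)
      (γ := fun y : Σ i, List (β i) => List (β y.1)) (fun y => enc y.1)
      (fun y l => .ofList (l.map (enc y.1))) (fun y => y.2) (fun _ b => [b]) 1 id.snd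
      (id.snd.pair nil) ?_
    rintro ⟨i, l⟩ _
    simp only [Pi.zero_apply, eval_one]
    nlinarith [Nat.zero_le (Nat.clog 2 l.length * (2 * l.length + 1))]
  refine (hloop.call' (fun y : Σ i, List (β i) => (⟨y.1, y.2.map fun b => [b]⟩ : Σ i, List (List (β i))))
    (id.fst.pair hsing) ?_).snd.hd.congr ?_
  · rintro ⟨i, l⟩ _
    refine ⟨trivial, ?_, le_rfl⟩
    have : (l.map fun b => [b]).flatten.length = l.length := by
      rw [← List.flatMap_def]
      simp
    simp only [this, List.length_map]
    nlinarith
  · intro y _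
    exact hd_ofList_lists _ _

theorem computes_sweep
    (hle : Computes (fun _ => True) 0 (fun y : Σ i, β i × β i => size y.1)
      (fun y => .cons (inp y.1) (.cons (enc y.1 y.2.1) (enc y.1 y.2.2)))
      (fun y => .ofBool (le y.1 y.2.1 y.2.2))) :
    Computes (fun _ => True) (fun y : Σ i, List (β i) => y.2.length)
      (fun y => size y.1) (fun y => .cons (inp y.1) (.ofList (y.2.map (enc y.1))))
      (fun y => .ofList ((y.2.foldl (sweepStep (le y.1)) []).map (enc y.1))) := by
  refine foldl (M₂ := 0) (β := fun y : Σ i, List (β i) => β y.1)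
    (σ := fun y : Σ i, List (β i) => List (β y.1)) (fun y s => .ofList (s.map (enc y.1)))
    (fun y => enc y.1) (fun y => y.2) (fun _ => []) (fun y => sweepStep (le y.1)) 1 id.snd nil ?_ ?_
  · let e : (Σ y : (Σ i, List (β i)), List (β y.1) × β y.1) → Data := fun z =>
      .cons (.cons (inp z.1.1) (.ofList (z.1.2.map (enc z.1.1))))
        (.cons (.ofList (z.2.1.map (enc z.1.1))) (enc z.1.1 z.2.2))
    have hbetter : ∀ {D : _ → Prop}, Computes D 0 (fun z => size z.1.1) e fun z => .ofBool
        (match z.2.1 with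
          | [] => false
          | y :: _ => le z.1.1 y z.2.2) := by
      intro D
      classical
      refine (ite (p := fun z : Σ y : (Σ i, List (β i)), List (β y.1) × β y.1 => z.2.1 ≠ [])
        (c := fun z => .ofList (z.2.1.map (enc z.1.1))) (b := fun z => .ofBool (match z.2.1 with
          | [] => false
          | y :: _ => le z.1.1 y z.2.2)) id.snd.fst ?_
        ((id.fst.fst.pair (id.snd.fst.hd.pair id.snd.snd)).comp (hle.sub (X + 1) ?_))
        (const (.ofBool false))).congr ?_
      · simp [Data.ofList_eq_nil_iff]
      · rintro ⟨⟨i, l⟩, _ | ⟨y, o⟩, x⟩ ⟨-, h⟩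
        · exact absurd rfl h
        · exact ⟨⟨i, y, x⟩, trivial, rfl, rfl, by simp, by simp⟩
      · rintro ⟨⟨i, l⟩, _ | ⟨y, o⟩, x⟩ _ <;> simp
    refine (bool_ite hbetter id.snd.fst (id.snd.snd.pair id.snd.fst)).congr ?_
    rintro ⟨⟨i, l⟩, _ | ⟨y, o⟩, x⟩ _
    · rfl
    · by_cases h : le i y x = true
      · simp [h, sweepStep]
      · simp [h, sweepStep, Data.ofList]
  · intro y _
    simp

end Computes

/-! ### Serial dictatorship -/

section Dictatorship

variable {U : Type*} (d : U)

/-- The first two elements of a list of candidates are compared; the better one stays in front, the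
other one goes to the end. (`d` is a default value that is irrelevant for lists with at least two
elements.) -/
def contest (better : U → U → List U → Bool) (R : List U) : List U :=
  if better (R.headD d) (R.tail.headD d) R.tail.tail = true then
    R.headD d :: (R.tail.tail ++ [R.tail.headD d])
  else R.tail.headD d :: (R.tail.tail ++ [R.headD d])

/-- A turn of the serial dictatorship: the state consists of the list of the users that have been
chosen, in reverse order, and the list of the remaining users; repeated contests bring the best of
the latter to the front. -/
def chooseStep {β : Type*} (better : List U → U → U → List U → Bool) (clock : List β)
    (s : List U × List U) : List U × List U :=
  ((clock.foldl (fun R _ => contest d (better s.1) R) s.2).headD d :: s.1,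
    (clock.foldl (fun R _ => contest d (better s.1) R) s.2).tail)

/-- The users in the order in which they are chosen, followed by those that are not chosen. -/
def dictatorship {β γ : Type*} (better : List U → U → U → List U → Bool) (clock : List β)
    (turns : List γ) (users : List U) : List U :=
  let s := turns.foldl (fun s _ => chooseStep d better clock s) ([], users)
  s.1.reverse ++ s.2

theorem length_contest_le (better : U → U → List U → Bool) (R : List U) :
    (contest d better R).length ≤ max R.length 2 := by
  unfold contest
  match R with
  | [] => split <;> simp
  | [_] => split <;> simp
  | _ :: _ :: _ => split <;> simp

theorem length_foldl_contest_le {β : Type*} (better : U → U → List U → Bool) (clock : List β)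
    (R : List U) :
    (clock.foldl (fun R _ => contest d better R) R).length ≤ max R.length 2 := by
  induction clock generalizing R with
  | nil => simp
  | cons _ clock ih =>
    have h := ih (contest d better R)
    have := length_contest_le d better R
    simp only [List.foldl_cons]
    omega

theorem length_foldl_chooseStep_le {β γ : Type*} (better : List U → U → U → List U → Bool)
    (clock : List β) (turns : List γ) (s : List U × List U) :
    (turns.foldl (fun s _ => chooseStep d better clock s) s).1.length = s.1.length + turns.length ∧
      (turns.foldl (fun s _ => chooseStep d better clock s) s).2.length ≤ max s.2.length 2 := by
  induction turns generalizing s with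
  | nil => simp
  | cons _ turns ih =>
    obtain ⟨h₁, h₂⟩ := ih (chooseStep d better clock s)
    have := length_foldl_contest_le d (better s.1) clock s.2
    simp only [List.foldl_cons]
    refine ⟨by rw [h₁]; simp [chooseStep]; omega, h₂.trans ?_⟩
    simp only [chooseStep, List.length_tail]
    omega

/-- Each of the first players gets the best user that is left. -/
def IsGreedy {A : Type*} [LE A] (cost : ℕ → U → A) (m : ℕ) (f : List U) : Prop :=
  ∀ i < m, ∃ u rest, f.drop i = u :: rest ∧ ∀ v ∈ rest, cost i u ≤ cost i v

variable {d} {A : Type*} [LinearOrder A]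

theorem foldl_contest_spec {β : Type*} {better : U → U → List U → Bool} {cost : U → A}
    {R₀ : List U} (hlen : 2 ≤ R₀.length)
    (hbetter : ∀ u v rest, (u :: v :: rest).Perm R₀ → (better u v rest = true ↔ cost u ≤ cost v))
    (clock : List β) (hclock : R₀.length ≤ clock.length) :
    (clock.foldl (fun R _ => contest d better R) R₀).Perm R₀ ∧
      ∃ u rest, clock.foldl (fun R _ => contest d better R) R₀ = u :: rest ∧
        ∀ v ∈ rest, cost u ≤ cost v := by
  -- `B` holds the candidates that have already lost a contest.
  have key : ∀ (clock : List β) (u : U) (A B : List U), (u :: (A ++ B)).Perm R₀ →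
      A.length ≤ clock.length → (∀ b ∈ B, cost u ≤ cost b) →
      (clock.foldl (fun R _ => contest d better R) (u :: (A ++ B))).Perm R₀ ∧
      ∃ v rest, clock.foldl (fun R _ => contest d better R) (u :: (A ++ B)) = v :: rest ∧
        ∀ w ∈ rest, cost v ≤ cost w := by
    intro clock
    induction clock with
    | nil =>
      intro u A B hp hA hB
      have : A = [] := by simpa using hA
      subst this
      exact ⟨hp, u, B, rfl, hB⟩
    | cons _ clock ih =>
      intro u A B hp hA hB
      match A, B with
      | [], [] =>
        have := hp.length_eq
        simp at this
        omega
      | [], b :: B =>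
        have h : contest d better (u :: ([] ++ b :: B)) = u :: ([] ++ (B ++ [b])) := by
          have := (hbetter u b B hp).2 (hB b (by simp))
          simp [contest, this]
        rw [List.foldl_cons, h]
        refine ih u [] _ (List.Perm.trans ?_ hp) (by simp) ?_
        · exact (List.perm_append_comm (l₁ := B) (l₂ := [b])).cons u
        · intro w hw
          exact hB w (by simpa [or_comm] using hw)
      | a :: A, B =>
        have hA' : A.length ≤ clock.length := by simpa using hA
        by_cases hua : better u a (A ++ B) = true
        · have h : contest d better (u :: (a :: A ++ B)) = u :: (A ++ (B ++ [a])) := by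
            simp [contest, hua]
          rw [List.foldl_cons, h]
          refine ih u A _ (List.Perm.trans ?_ hp) hA' ?_
          · rw [← List.append_assoc]
            exact (List.perm_append_comm (l₁ := A ++ B) (l₂ := [a])).cons u
          · intro w hw
            rcases List.mem_append.1 hw with hw | hw
            · exact hB w hw
            · rw [List.mem_singleton.1 hw]
              exact (hbetter u a _ hp).1 hua
        · have h : contest d better (u :: (a :: A ++ B)) = a :: (A ++ (B ++ [u])) := by
            simp [contest, hua]
          have hau : cost a ≤ cost u := by
            exact (not_le.1 fun h => hua ((hbetter u a _ hp).2 h)).le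
          rw [List.foldl_cons, h]
          refine ih a A _ (List.Perm.trans ?_ hp) hA' ?_
          · rw [← List.append_assoc]
            exact ((List.perm_append_comm (l₁ := A ++ B) (l₂ := [u])).cons a).trans
              (List.Perm.swap u a _)
          · intro w hw
            rcases List.mem_append.1 hw with hw | hw
            · exact hau.trans (hB w hw)
            · rwa [List.mem_singleton.1 hw]
  match R₀ with
  | [] => simp at hlen
  | u :: R =>
    have := key clock u R [] (by simp) (by simp at hclock; omega) (by simp)
    simpa using this

theorem dictatorship_spec {β γ : Type*} {better : List U → U → U → List U → Bool}
    {cost : ℕ → U → A} {clock : List β} {turns : List γ} {users : List U}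
    (hclock : users.length ≤ clock.length) (hturns : turns.length < users.length)
    (hbetter : ∀ T u v rest, T.length < turns.length → (T.reverse ++ u :: v :: rest).Perm users →
      (better T u v rest = true ↔ cost T.length u ≤ cost T.length v)) :
    (dictatorship d better clock turns users).Perm users ∧
      IsGreedy cost turns.length (dictatorship d better clock turns users) := by
  have key : ∀ (pre post : List γ), turns = pre ++ post →
      let s := pre.foldl (fun s _ => chooseStep d better clock s) ([], users)
      (s.1.reverse ++ s.2).Perm users ∧ IsGreedy cost pre.length (s.1.reverse ++ s.2) := by
    intro pre
    induction pre using List.reverseRecOn with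
    | nil => simp [IsGreedy]
    | append_singleton pre b ih =>
      intro post hpost
      obtain ⟨hp, hg⟩ := ih (b :: post) (by simp [hpost])
      obtain ⟨hT, -⟩ := length_foldl_chooseStep_le d better clock pre ([], users)
      rw [List.foldl_append, List.foldl_cons, List.foldl_nil]
      set s := pre.foldl (fun s _ => chooseStep d better clock s) ([], users) with hs
      simp only [List.length_nil, zero_add] at hT
      have hl := hp.length_eq
      have hpre : pre.length < turns.length := by rw [hpost]; simp
      simp only [List.length_append, List.length_reverse] at hl
      obtain ⟨hc, u, rest, hu, hrest⟩ := foldl_contest_spec (d := d) (better := better s.1)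
        (cost := cost s.1.length) (R₀ := s.2) (by omega)
        (fun u v rest h => hbetter s.1 u v rest (by omega) ((h.append_left _).trans hp)) clock
        (by omega)
      have hstep : chooseStep d better clock s = (u :: s.1, rest) := by simp [chooseStep, hu]
      rw [hu] at hc
      rw [hstep]
      simp only [List.reverse_cons, List.append_assoc, List.singleton_append]
      refine ⟨(hc.append_left _).trans hp, fun i hi => ?_⟩
      simp only [List.length_append, List.length_singleton] at hi
      rcases Nat.lt_succ_iff_lt_or_eq.1 hi with hi | rfl
      · obtain ⟨w, tail, hw, htail⟩ := hg i hi
        have hi' : i < s.1.reverse.length := by simp; omega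
        rw [List.drop_append_of_le_length hi'.le, List.drop_eq_getElem_cons hi'] at hw ⊢
        simp only [List.cons_append, List.cons.injEq] at hw
        refine ⟨_, _, rfl, fun v hv => ?_⟩
        rw [hw.1]
        refine htail v ?_
        rw [← hw.2]
        exact ((hc.append_left _).mem_iff).1 hv
      · refine ⟨u, rest, ?_, ?_⟩
        · rw [← hT, ← List.length_reverse, List.drop_left]
        · rwa [hT] at hrest
  exact key turns [] (by simp)

end Dictatorship

/-! ### Running the serial dictatorship -/

/-- Lists of users as trees. -/
def Data.ofUsers {n : ℕ} (l : List (Fin n)) : Data := .ofList (l.map fun u : Fin n => .ofUnary u)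

theorem Data.tl_ofUsers {n : ℕ} (l : List (Fin n)) : (Data.ofUsers l).tl = .ofUsers l.tail := by
  cases l <;> rfl

section Plans

variable {k n : ℕ} [NeZero n]

/-- The plan that gives the block `φ ⁻¹ {j}` of steps to the `j`-th user of the list `f`. -/
def planOf (φ : Fin k → Fin k) (f : List (Fin n)) : Fin k → Fin n :=
  fun s => (f.drop (φ s)).headD 0

/-- Comparison of two users `u`, `v` for the next block, if the users in `T` (in reverse order)
have been given to the previous blocks. The other blocks are given to the users in `rest`, so that
two complete plans can be compared; ties are broken by the names of the users. -/
def betterUser (le : (Fin k → Fin n) → (Fin k → Fin n) → Bool) (φ : Fin k → Fin k)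
    (T : List (Fin n)) (u v : Fin n) (rest : List (Fin n)) : Bool :=
  if le (planOf φ (T.reverse ++ u :: rest)) (planOf φ (T.reverse ++ v :: rest)) = true then
    if le (planOf φ (T.reverse ++ v :: rest)) (planOf φ (T.reverse ++ u :: rest)) = true then
      decide ((u : ℕ) ≤ v)
    else true
  else false

/-- The plan found by the serial dictatorship of the blocks `φ ⁻¹ {0}`, `φ ⁻¹ {1}`, …. -/
def greedyPlan (le : (Fin k → Fin n) → (Fin k → Fin n) → Bool) (φ : Fin k → Fin k) : Fin k → Fin n :=
  planOf φ (dictatorship 0 (betterUser le φ) (List.finRange n) (List.replicate k ())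
    (List.finRange n))

theorem Data.hd_ofUsers (l : List (Fin n)) :
    (Data.ofUsers l).hd = .ofUnary ((l.headD 0 : Fin n) : ℕ) := by
  cases l
  · simp only [List.headD_nil, Fin.val_zero]
    rfl
  · rfl

end Plans

namespace Computes

section

variable {α : Type*} {D : α → Prop} {M N : α → ℕ} {a : α → Data} {n : α → ℕ}
  {l : ∀ x, List (Fin (n x))}

theorem headUser [∀ x, NeZero (n x)] (h : Computes D M N a fun x => .ofUsers (l x)) :
    Computes D M N a fun x => .ofUnary (((l x).headD 0 : Fin (n x)) : ℕ) :=
  h.hd.congr fun _ _ => Data.hd_ofUsers _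

theorem tailUsers (h : Computes D M N a fun x => .ofUsers (l x)) :
    Computes D M N a fun x => .ofUsers (l x).tail :=
  h.tl.congr fun _ _ => Data.tl_ofUsers _

theorem reverseAppendUsers {m : ∀ x, List (Fin (n x))} (r : ℕ[X])
    (hl : Computes D M N a fun x => .ofUsers (l x)) (hm : Computes D M N a fun x => .ofUsers (m x))
    (hlen : ∀ x, D x → (l x).length ≤ (M x + 1) * r.eval (N x)) :
    Computes D M N a fun x => .ofUsers ((l x).reverse ++ m x) :=
  (reverseAppend (l := fun x => (l x).map fun u : Fin (n x) => .ofUnary u)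
    (m := fun x => (m x).map fun u : Fin (n x) => .ofUnary u) r hl hm (by simpa using hlen)).congr
    fun x _ => by simp [Data.ofUsers]

end

variable {I : Type*} {k n : I → ℕ} [∀ i, NeZero (n i)] {inp : I → Data} {size : I → ℕ}
  {le : ∀ i, (Fin (k i) → Fin (n i)) → (Fin (k i) → Fin (n i)) → Bool}

theorem computes_planOf (hkn : ∀ i, k i + n i ≤ size i) : Computes (fun _ => True) 0
    (fun y : Σ i, (Fin (k i) → Fin (k i)) × List (Fin (n i)) => size y.1)
    (fun y => .cons (.ofPlan y.2.1) (.ofUsers y.2.2)) (fun y => .ofPlan (planOf y.2.1 y.2.2)) := by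
  have h := map (α := Σ i, (Fin (k i) → Fin (k i)) × List (Fin (n i))) (D := fun _ => True)
    (M := 0) (N := fun y => size y.1) (M₂ := 0) (a := fun y => .cons (.ofPlan y.2.1) (.ofUsers y.2.2))
    (β := fun y => Fin (k y.1)) (γ := fun y => Fin (n y.1)) (fun _ j => .ofUnary (j : ℕ))
    (fun _ u => .ofUnary (u : ℕ)) (fun y => List.ofFn y.2.1)
    (fun y j => (y.2.2.drop j).headD 0) X
    (Computes.congr (b := fun y => .ofPlan y.2.1) id.fst fun y _ => by
      simp [Data.ofPlan, List.map_ofFn, Function.comp_def])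
    (by
      have h : Computes (fun z : Σ y : (Σ i, (Fin (k i) → Fin (k i)) × List (Fin (n i))), Fin (k y.1) =>
          True ∧ z.2 ∈ List.ofFn z.1.2.1) 0 (fun z => size z.1.1)
          (fun z => .cons (.cons (.ofPlan z.1.2.1) (.ofUsers z.1.2.2)) (.ofUnary (z.2 : ℕ)))
          (fun z => .ofUsers (z.1.2.2.drop z.2)) := by
        refine (drop.call (fun z : Σ y : (Σ i, (Fin (k i) → Fin (k i)) × List (Fin (n i))), Fin (k y.1) =>
            ((z.2 : ℕ), z.1.2.2.map fun u : Fin (n z.1.1) => .ofUnary u)) (X + 1) (id.snd.pair id.fst.snd)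
            ?_).congr ?_
        · rintro ⟨⟨i, φ, f⟩, j⟩ _
          have := hkn i
          refine ⟨trivial, by simp, ?_⟩
          simp only [eval_add, eval_X, eval_one]
          omega
        · intro z _
          simp [Data.ofUsers, List.map_drop]
      exact headUser (n := fun z : Σ y : (Σ i, (Fin (k i) → Fin (k i)) × List (Fin (n i))),
        Fin (k y.1) => n z.1.1) h)
    (by
      rintro ⟨i, φ, f⟩ _
      have := hkn i
      simp
      omega)
  exact h.congr fun y _ => by simp [Data.ofPlan, planOf, List.map_ofFn, Function.comp_def]

theorem computes_betterUser (hkn : ∀ i, k i + n i ≤ size i)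
    (hle : Computes (fun _ => True) 0
      (fun y : Σ i, (Fin (k i) → Fin (n i)) × (Fin (k i) → Fin (n i)) => size y.1)
      (fun y => .cons (inp y.1) (.cons (.ofPlan y.2.1) (.ofPlan y.2.2)))
      (fun y => .ofBool (le y.1 y.2.1 y.2.2))) :
    Computes (fun y : Σ i, (Fin (k i) → Fin (k i)) × List (Fin (n i)) × Fin (n i) × Fin (n i) ×
        List (Fin (n i)) => y.2.2.1.length ≤ k y.1) 0 (fun y => size y.1)
      (fun y => .cons (inp y.1) (.cons (.ofPlan y.2.1) (.cons (.ofUsers y.2.2.1)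
        (.cons (.ofUnary (y.2.2.2.1 : ℕ)) (.cons (.ofUnary (y.2.2.2.2.1 : ℕ))
          (.ofUsers y.2.2.2.2.2))))))
      (fun y => .ofBool (betterUser (le y.1) y.2.1 y.2.2.1 y.2.2.2.1 y.2.2.2.2.1 y.2.2.2.2.2)) := by
  let α := Σ i, (Fin (k i) → Fin (k i)) × List (Fin (n i)) × Fin (n i) × Fin (n i) × List (Fin (n i))
  let D : α → Prop := fun y => y.2.2.1.length ≤ k y.1
  let N : α → ℕ := fun y => size y.1
  let e : α → Data := fun y => .cons (inp y.1) (.cons (.ofPlan y.2.1) (.cons (.ofUsers y.2.2.1)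
        (.cons (.ofUnary (y.2.2.2.1 : ℕ)) (.cons (.ofUnary (y.2.2.2.2.1 : ℕ))
          (.ofUsers y.2.2.2.2.2)))))
  have hi : ∀ {D : α → Prop}, Computes D 0 N e fun y => inp y.1 := id.fst
  have hu : ∀ {D : α → Prop}, Computes D 0 N e fun y => .ofUnary (y.2.2.2.1 : ℕ) :=
    id.snd.snd.snd.fst
  have hv : ∀ {D : α → Prop}, Computes D 0 N e fun y => .ofUnary (y.2.2.2.2.1 : ℕ) :=
    id.snd.snd.snd.snd.fst
  have hr : ∀ {D : α → Prop}, Computes D 0 N e fun y => .ofUsers y.2.2.2.2.2 :=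
    id.snd.snd.snd.snd.snd
  have hplan : ∀ w : ∀ y : α, Fin (n y.1), Computes D 0 N e (fun y => .ofUnary (w y : ℕ)) →
      Computes D 0 N e fun y => .ofPlan (planOf y.2.1 (y.2.2.1.reverse ++ w y :: y.2.2.2.2.2)) := by
    intro w hw
    refine (computes_planOf hkn).call'
      (fun y : α => ⟨y.1, y.2.1, y.2.2.1.reverse ++ w y :: y.2.2.2.2.2⟩)
      (id.snd.fst.pair (reverseAppendUsers X id.snd.snd.fst (hw.pair hr) ?_))
      fun _ _ => ⟨trivial, le_rfl, le_rfl⟩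
    intro y hy
    have h₁ : y.2.2.1.length ≤ k y.1 := hy
    have := hkn y.1
    simp only [eval_X, Pi.zero_apply, N]
    omega
  have hpu := hplan (fun y => y.2.2.2.1) hu
  have hpv := hplan (fun y => y.2.2.2.2.1) hv
  have hlt : ∀ {D : α → Prop}, Computes D 0 N e
      fun y => .ofBool (decide ((y.2.2.2.1 : ℕ) ≤ (y.2.2.2.2.1 : ℕ))) := by
    intro D
    refine (ite (p := fun y : α => ¬ (y.2.2.2.1 : ℕ) ≤ (y.2.2.2.2.1 : ℕ))
      (drop.call (fun y : α => ((y.2.2.2.2.1 : ℕ), List.replicate (y.2.2.2.1 : ℕ) .nil)) (X + 1)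
        (hv.pair hu) ?_) ?_ (const (.ofBool false)) (const (.ofBool true))).congr ?_
    · intro y _
      have := hkn y.1
      refine ⟨trivial, by simp, ?_⟩
      simp only [eval_add, eval_X, eval_one, N]
      omega
    · intro y _
      simp [Data.ofList_eq_nil_iff, Nat.sub_eq_zero_iff_le]
    · intro y _
      by_cases h : (y.2.2.2.1 : ℕ) ≤ (y.2.2.2.2.1 : ℕ)
      · simp only [h, not_true, if_false, decide_true]
      · simp only [h, not_false_iff, if_true, decide_false]
  have h₁ := hle.call' (fun y : α => (⟨y.1, planOf y.2.1 (y.2.2.1.reverse ++ y.2.2.2.1 :: y.2.2.2.2.2),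
    planOf y.2.1 (y.2.2.1.reverse ++ y.2.2.2.2.1 :: y.2.2.2.2.2)⟩ :
      Σ i, (Fin (k i) → Fin (n i)) × (Fin (k i) → Fin (n i))))
    (hi.pair (hpu.pair hpv)) fun _ _ => ⟨trivial, le_rfl, le_rfl⟩
  have h₂ := hle.call' (fun y : α => (⟨y.1, planOf y.2.1 (y.2.2.1.reverse ++ y.2.2.2.2.1 :: y.2.2.2.2.2),
    planOf y.2.1 (y.2.2.1.reverse ++ y.2.2.2.1 :: y.2.2.2.2.2)⟩ :
      Σ i, (Fin (k i) → Fin (n i)) × (Fin (k i) → Fin (n i))))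
    (hi.pair (hpv.pair hpu)) fun _ _ => ⟨trivial, le_rfl, le_rfl⟩
  refine (bool_ite h₁ (bool_ite (h₂.mono (fun _ h => h.1) fun _ _ => le_rfl) hlt
    (const (.ofBool true))) (const (.ofBool false))).congr ?_
  intro y _
  simp only [betterUser, apply_ite Data.ofBool]

theorem computes_contest (hkn : ∀ i, k i + n i ≤ size i)
    (hle : Computes (fun _ => True) 0
      (fun y : Σ i, (Fin (k i) → Fin (n i)) × (Fin (k i) → Fin (n i)) => size y.1)
      (fun y => .cons (inp y.1) (.cons (.ofPlan y.2.1) (.ofPlan y.2.2)))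
      (fun y => .ofBool (le y.1 y.2.1 y.2.2))) :
    Computes (fun y : Σ i, (Fin (k i) → Fin (k i)) × List (Fin (n i)) × List (Fin (n i)) =>
        y.2.2.1.length ≤ k y.1 ∧ y.2.2.2.length ≤ n y.1 + 2) 0 (fun y => size y.1)
      (fun y => .cons (inp y.1) (.cons (.ofPlan y.2.1) (.cons (.ofUsers y.2.2.1)
        (.ofUsers y.2.2.2))))
      (fun y => .ofUsers (contest 0 (betterUser (le y.1) y.2.1 y.2.2.1) y.2.2.2)) := by
  let α := Σ i, (Fin (k i) → Fin (k i)) × List (Fin (n i)) × List (Fin (n i))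
  let N : α → ℕ := fun y => size y.1
  let e : α → Data := fun y => .cons (inp y.1) (.cons (.ofPlan y.2.1) (.cons (.ofUsers y.2.2.1)
        (.ofUsers y.2.2.2)))
  have hR : ∀ {D : α → Prop}, Computes D 0 N e fun y => .ofUsers y.2.2.2 := id.snd.snd.snd
  have hu : ∀ {D : α → Prop}, Computes D 0 N e fun y =>
      .ofUnary ((y.2.2.2.headD 0 : Fin (n y.1)) : ℕ) := hR.headUser
  have hv : ∀ {D : α → Prop}, Computes D 0 N e fun y =>
      .ofUnary ((y.2.2.2.tail.headD 0 : Fin (n y.1)) : ℕ) := hR.tailUsers.headUser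
  have hrest : ∀ {D : α → Prop}, Computes D 0 N e fun y => .ofUsers y.2.2.2.tail.tail :=
    hR.tailUsers.tailUsers
  have hnew : ∀ (D : α → Prop) (w x : ∀ y : α, Fin (n y.1)), (∀ y, D y → y.2.2.2.length ≤ n y.1 + 2) →
      Computes D 0 N e (fun y => .ofUnary (w y : ℕ)) →
      Computes D 0 N e (fun y => .ofUnary (x y : ℕ)) →
      Computes D 0 N e (fun y => .ofUsers (w y :: (y.2.2.2.tail.tail ++ [x y]))) := by
    intro D w x hD hw hx
    have hlen : ∀ y, D y → y.2.2.2.tail.tail.length ≤ (0 + 1) * (X : ℕ[X]).eval (N y) := by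
      intro y hy
      have := hD y hy
      have := hkn y.1
      simp only [List.length_tail, eval_X, N]
      omega
    have h₁ : Computes D 0 N e (fun y => .ofUsers (y.2.2.2.tail.tail.reverse ++ [])) :=
      reverseAppendUsers X hrest nil hlen
    refine hw.pair ((reverseAppendUsers (m := fun y => [x y]) X h₁ (hx.pair nil) ?_).congr ?_)
    · intro y hy
      simpa using hlen y hy
    · intro y _
      rw [List.append_nil, List.reverse_reverse]
      rfl
  refine (bool_ite ((computes_betterUser hkn hle).call'
    (fun y : α => (⟨y.1, y.2.1, y.2.2.1, y.2.2.2.headD 0, y.2.2.2.tail.headD 0, y.2.2.2.tail.tail⟩ :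
      Σ i, (Fin (k i) → Fin (k i)) × List (Fin (n i)) × Fin (n i) × Fin (n i) × List (Fin (n i))))
    (id.fst.pair (id.snd.fst.pair (id.snd.snd.fst.pair (hu.pair (hv.pair hrest)))))
    fun y hy => ⟨hy.1, le_rfl, le_rfl⟩)
    (hnew _ (fun y => y.2.2.2.headD 0) (fun y => y.2.2.2.tail.headD 0) (fun y hy => hy.1.2) hu hv)
    (hnew _ (fun y => y.2.2.2.tail.headD 0) (fun y => y.2.2.2.headD 0) (fun y hy => hy.1.2)
      hv hu)).congr ?_
  intro y _
  simp only [contest, apply_ite Data.ofUsers]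

theorem computes_chooseStep (hkn : ∀ i, k i + n i ≤ size i)
    (hn : Computes (fun _ => True) 0 size inp fun i => .ofUsers (List.finRange (n i)))
    (hle : Computes (fun _ => True) 0
      (fun y : Σ i, (Fin (k i) → Fin (n i)) × (Fin (k i) → Fin (n i)) => size y.1)
      (fun y => .cons (inp y.1) (.cons (.ofPlan y.2.1) (.ofPlan y.2.2)))
      (fun y => .ofBool (le y.1 y.2.1 y.2.2))) :
    Computes (fun y : Σ i, (Fin (k i) → Fin (k i)) × List (Fin (n i)) × List (Fin (n i)) =>
        y.2.2.1.length ≤ k y.1 ∧ y.2.2.2.length ≤ n y.1 + 2) 0 (fun y => size y.1)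
      (fun y => .cons (inp y.1) (.cons (.ofPlan y.2.1) (.cons (.ofUsers y.2.2.1)
        (.ofUsers y.2.2.2))))
      (fun y => .cons
        (.ofUsers (chooseStep 0 (betterUser (le y.1) y.2.1) (List.finRange (n y.1)) y.2.2).1)
        (.ofUsers (chooseStep 0 (betterUser (le y.1) y.2.1) (List.finRange (n y.1)) y.2.2).2)) := by
  let α := Σ i, (Fin (k i) → Fin (k i)) × List (Fin (n i)) × List (Fin (n i))
  have h := foldl (α := α)
    (D := fun y => y.2.2.1.length ≤ k y.1 ∧ y.2.2.2.length ≤ n y.1 + 2) (M := 0)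
    (N := fun y => size y.1) (M₂ := 0)
    (a := fun y => .cons (inp y.1) (.cons (.ofPlan y.2.1) (.cons (.ofUsers y.2.2.1)
      (.ofUsers y.2.2.2)))) (β := fun y => Fin (n y.1)) (σ := fun y => List (Fin (n y.1)))
    (fun _ => .ofUsers) (fun _ u => .ofUnary (u : ℕ)) (fun y => List.finRange (n y.1))
    (fun y => y.2.2.2) (fun y R _ => contest 0 (betterUser (le y.1) y.2.1 y.2.2.1) R) X
    (hn.call' (fun y : α => y.1) id.fst fun _ _ => ⟨trivial, le_rfl, le_rfl⟩) id.snd.snd.snd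
    ((computes_contest hkn hle).call'
      (fun z : Σ y : α, List (Fin (n y.1)) × Fin (n y.1) =>
        (⟨z.1.1, z.1.2.1, z.1.2.2.1, z.2.1⟩ : α))
      (id.fst.fst.pair (id.fst.snd.fst.pair (id.fst.snd.snd.fst.pair id.snd.fst))) (by
        rintro ⟨⟨i, φ, T, R⟩, R', u⟩ ⟨⟨h₁, h₂⟩, pre, post, -, h₃⟩
        have h₄ := length_foldl_contest_le 0 (betterUser (le i) φ T) pre R
        simp only at h₁ h₂ h₃
        rw [← h₃] at h₄
        refine ⟨⟨h₁, ?_⟩, le_rfl, le_rfl⟩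
        simp only
        omega))
    (by
      rintro ⟨i, φ, T, R⟩ _
      have := hkn i
      simp
      omega)
  exact (h.headUser.pair id.snd.snd.fst).pair h.tailUsers

theorem computes_greedyPlan (hkn : ∀ i, k i + n i ≤ size i)
    (hk : Computes (fun _ => True) 0 size inp fun i => .ofUnary (k i))
    (hn : Computes (fun _ => True) 0 size inp fun i => .ofUsers (List.finRange (n i)))
    (hle : Computes (fun _ => True) 0
      (fun y : Σ i, (Fin (k i) → Fin (n i)) × (Fin (k i) → Fin (n i)) => size y.1)
      (fun y => .cons (inp y.1) (.cons (.ofPlan y.2.1) (.ofPlan y.2.2)))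
      (fun y => .ofBool (le y.1 y.2.1 y.2.2))) :
    Computes (fun _ => True) 0 (fun y : Σ i, Fin (k i) → Fin (k i) => size y.1)
      (fun y => .cons (inp y.1) (.ofPlan y.2))
      (fun y => .ofPlan (greedyPlan (le y.1) y.2)) := by
  let α := Σ i, Fin (k i) → Fin (k i)
  have h := foldl (α := α) (D := fun _ => True) (M := 0) (N := fun y => size y.1) (M₂ := 0)
    (a := fun y => .cons (inp y.1) (.ofPlan y.2)) (β := fun _ => Unit)
    (σ := fun y => List (Fin (n y.1)) × List (Fin (n y.1)))
    (fun _ s => .cons (.ofUsers s.1) (.ofUsers s.2)) (fun _ _ => .nil)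
    (fun y => List.replicate (k y.1) ()) (fun y => ([], List.finRange (n y.1)))
    (fun y s _ => chooseStep 0 (betterUser (le y.1) y.2) (List.finRange (n y.1)) s) X
    ((hk.call' (fun y : α => y.1) id.fst fun _ _ => ⟨trivial, le_rfl, le_rfl⟩).congr
      fun y _ => by simp [Data.ofUnary])
    (nil.pair (hn.call' (fun y : α => y.1) id.fst fun _ _ => ⟨trivial, le_rfl, le_rfl⟩))
    ((computes_chooseStep hkn hn hle).call'
      (fun z : Σ y : α, (List (Fin (n y.1)) × List (Fin (n y.1))) × Unit =>
        (⟨z.1.1, z.1.2, z.2.1.1, z.2.1.2⟩ :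
          Σ i, (Fin (k i) → Fin (k i)) × List (Fin (n i)) × List (Fin (n i))))
      (id.fst.fst.pair (id.fst.snd.pair id.snd.fst)) (by
        rintro ⟨⟨i, φ⟩, s, u⟩ ⟨-, pre, post, h₃, h₄⟩
        obtain ⟨h₁, h₂⟩ := length_foldl_chooseStep_le 0 (betterUser (le i) φ)
          (List.finRange (n i)) pre ([], List.finRange (n i))
        have h₅ := congrArg List.length h₃
        simp only at h₄
        rw [← h₄] at h₁ h₂
        simp only [List.length_replicate, List.length_append, List.length_cons, List.length_nil,
          List.length_finRange] at h₁ h₂ h₅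
        refine ⟨⟨?_, ?_⟩, le_rfl, le_rfl⟩
        · simp only
          omega
        · simp only
          omega))
    (by
      rintro ⟨i, φ⟩ _
      have := hkn i
      simp
      omega)
  refine (computes_planOf hkn).call' (fun y : α => ⟨y.1, y.2, dictatorship 0 (betterUser (le y.1) y.2)
    (List.finRange (n y.1)) (List.replicate (k y.1) ()) (List.finRange (n y.1))⟩)
    (id.snd.pair (reverseAppendUsers X h.fst h.snd ?_)) fun _ _ => ⟨trivial, le_rfl, le_rfl⟩
  rintro ⟨i, φ⟩ _
  obtain ⟨h₁, -⟩ := length_foldl_chooseStep_le 0 (betterUser (le i) φ)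
    (List.finRange (n i)) (List.replicate (k i) ()) ([], List.finRange (n i))
  have := hkn i
  simp only [List.length_replicate, List.length_nil] at h₁
  simp only [h₁, Pi.zero_apply, eval_X]
  omega

end Computes

/-! ### Optimal assignments are found by a serial dictatorship -/

section Assignment

variable {J U A : Type*} [Fintype J] [AddCommMonoid A] [LinearOrder A] [IsOrderedCancelAddMonoid A]
  {c : J → U → A} {g : J → U}

/-- In an optimal assignment, some player outside `K` has the best user among those not assigned to
players in `K`: otherwise the players outside `K` could improve by trading along the cycles of the
map that sends a player to the owner of a better user. -/
theorem exists_best_of_optimal (hg : Function.Injective g)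
    (hopt : ∀ g' : J → U, Function.Injective g' → ∑ j, c j (g j) ≤ ∑ j, c j (g' j))
    {K : Set J} (hK : ∃ j, j ∉ K) : ∃ j, j ∉ K ∧ ∀ u ∉ g '' K, c j (g j) ≤ c j u := by
  classical
  obtain ⟨j₀, hj₀⟩ := hK
  have : Nonempty J := ⟨j₀⟩
  have : Nonempty U := ⟨g j₀⟩
  by_contra! hno
  choose! h hh hlt using hno
  by_cases hfree : ∃ j, j ∉ K ∧ h j ∉ Set.range g
  · obtain ⟨j, hj, hjr⟩ := hfree
    have hinj : Function.Injective (Function.update g j (h j)) := by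
      intro a b hab
      by_cases ha : a = j <;> by_cases hb : b = j
      · rw [ha, hb]
      · subst ha
        rw [Function.update_self, Function.update_of_ne hb] at hab
        exact absurd ⟨b, hab.symm⟩ hjr
      · subst hb
        rw [Function.update_self, Function.update_of_ne ha] at hab
        exact absurd ⟨a, hab⟩ hjr
      · rw [Function.update_of_ne ha, Function.update_of_ne hb] at hab
        exact hg hab
    refine absurd (hopt _ hinj) (not_le.2 (Finset.sum_lt_sum (fun i _ => ?_)
      ⟨j, Finset.mem_univ _, ?_⟩))
    · by_cases hi : i = j
      · subst hi
        simpa using (hlt i hj).le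
      · simp [Function.update_of_ne hi]
    · simpa using hlt j hj
  · have hown : ∀ j, j ∉ K → ∃ i, g i = h j := by
      intro j hj
      by_contra hj'
      exact hfree ⟨j, hj, hj'⟩
    choose! σ' hσ' using hown
    let σ : J → J := fun j => if j ∈ K then j else σ' j
    have hσK : ∀ j, j ∉ K → σ j ∉ K := by
      intro j hj hK
      simp only [σ, hj, if_false] at hK
      exact hh j hj ⟨σ' j, hK, hσ' j hj⟩
    have hbij := Function.bijOn_periodicPts (f := σ)
    let τ : J → J := fun j => if j ∈ Function.periodicPts σ then σ j else j
    have hτ : Function.Injective τ := by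
      intro a b hab
      by_cases ha : a ∈ Function.periodicPts σ <;> by_cases hb : b ∈ Function.periodicPts σ <;>
        simp only [τ, ha, hb, if_true, if_false] at hab
      · exact hbij.injOn ha hb hab
      · exact absurd (hab ▸ hbij.mapsTo ha) hb
      · exact absurd (hab ▸ hbij.mapsTo hb) ha
      · exact hab
    -- A cycle outside `K`.
    obtain ⟨j, hjK, hjp⟩ : ∃ j, j ∉ K ∧ j ∈ Function.periodicPts σ := by
      have hout : ∀ m, σ^[m] j₀ ∉ K := by
        intro m
        induction m with
        | zero => exact hj₀
        | succ m ih =>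
          rw [Function.iterate_succ_apply']
          exact hσK _ ih
      obtain ⟨m, n, hmn, he⟩ := Finite.exists_ne_map_eq_of_infinite fun m : ℕ => σ^[m] j₀
      wlog hlt : m < n generalizing m n
      · exact this n m hmn.symm he.symm (by omega)
      refine ⟨σ^[m] j₀, hout m, Function.mk_mem_periodicPts (n := n - m) (by omega) ?_⟩
      rw [Function.IsPeriodicPt, Function.IsFixedPt, ← Function.iterate_add_apply,
        Nat.sub_add_cancel hlt.le]
      exact he.symm
    have hstep : ∀ i, i ∈ Function.periodicPts σ → i ∉ K → c i (g (τ i)) < c i (g i) := by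
      intro i hi hiK
      have : τ i = σ' i := by simp [τ, σ, hi, hiK]
      rw [this, hσ' i hiK]
      exact hlt i hiK
    refine absurd (hopt _ (hg.comp hτ)) (not_le.2 (Finset.sum_lt_sum (fun i _ => ?_)
      ⟨j, Finset.mem_univ _, hstep j hjp hjK⟩))
    by_cases hi : i ∈ Function.periodicPts σ
    · by_cases hiK : i ∈ K
      · simp [τ, σ, hi, hiK]
      · exact (hstep i hi hiK).le
    · simp [τ, hi]

/-- For an optimal assignment there is an order of the players in which each player gets the best
user that is left. -/
theorem exists_order_of_optimal {k : ℕ} {c : Fin k → U → A} {g : Fin k → U}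
    (hg : Function.Injective g)
    (hopt : ∀ g' : Fin k → U, Function.Injective g' → ∑ j, c j (g j) ≤ ∑ j, c j (g' j)) :
    ∃ e : Equiv.Perm (Fin k), ∀ i, ∀ u, (∀ i' < i, g (e i') ≠ u) → c (e i) (g (e i)) ≤ c (e i) u := by
  have key : ∀ m ≤ k, ∃ l : List (Fin k), l.Nodup ∧ l.length = m ∧
      ∀ (i : ℕ) (hi : i < l.length) (u : U), (∀ x ∈ l.take i, g x ≠ u) →
        c l[i] (g l[i]) ≤ c l[i] u := by
    intro m
    induction m with
    | zero => exact fun _ => ⟨[], by simp⟩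
    | succ m ih =>
      intro hm
      obtain ⟨l, hl, hlen, hbest⟩ := ih (by omega)
      have hK : ∃ j, j ∉ {x | x ∈ l} := by
        by_contra! hall
        have := Finset.card_le_card (fun x _ => List.mem_toFinset.2 (hall x) :
          (Finset.univ : Finset (Fin k)) ⊆ l.toFinset)
        rw [List.toFinset_card_of_nodup hl, Finset.card_univ, Fintype.card_fin] at this
        omega
      obtain ⟨j, hj, hjb⟩ := exists_best_of_optimal hg hopt hK
      refine ⟨l ++ [j], ?_, by simp [hlen], ?_⟩
      · rw [List.nodup_append]
        refine ⟨hl, by simp, ?_⟩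
        intro a ha b hb
        rw [List.mem_singleton.1 hb]
        rintro rfl
        exact hj ha
      · intro i hi u hu
        rcases Nat.lt_or_ge i l.length with h | h
        · rw [List.getElem_append_left h]
          rw [List.take_append_of_le_length h.le] at hu
          exact hbest i h u hu
        · have hi' : i = l.length := by
            simp at hi
            omega
          subst hi'
          simp only [List.getElem_concat_length, List.take_left] at hu ⊢
          refine hjb u ?_
          rintro ⟨x, hx, rfl⟩
          exact hu x hx rfl
  obtain ⟨l, hl, hlen, hbest⟩ := key k le_rfl
  have hinj : Function.Injective fun i : Fin k => l[(i : ℕ)]'(by omega) := by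
    intro a b hab
    exact Fin.ext ((hl.getElem_inj_iff).1 hab)
  refine ⟨Equiv.ofBijective _ (Finite.injective_iff_bijective.1 hinj), fun i u hu => ?_⟩
  refine hbest i (by omega) u fun x hx => ?_
  obtain ⟨m, hm, rfl⟩ := List.mem_iff_getElem.1 hx
  simp only [List.length_take] at hm
  rw [List.getElem_take]
  exact hu ⟨m, by omega⟩ (by simp [Fin.lt_def]; omega)

end Assignment

/-- The outcome of a serial dictatorship in the right order is the optimal assignment. -/
theorem IsGreedy.drop_eq {U A : Type*} [LinearOrder A] {k : ℕ} {c : Fin k → U → A} {g : Fin k → U}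
    (hc : ∀ j, Function.Injective (c j)) {e : Equiv.Perm (Fin k)} (hg : Function.Injective g)
    (he : ∀ i, ∀ u, (∀ i' < i, g (e i') ≠ u) → c (e i) (g (e i)) ≤ c (e i) u)
    {cost : ℕ → U → A} (hcost : ∀ i : Fin k, cost i = c (e i)) {f : List U} (hf : f.Nodup)
    (hall : ∀ u, u ∈ f) (hgreedy : IsGreedy cost k f) (i : Fin k) :
    ∃ rest, f.drop i = g (e i) :: rest := by
  obtain ⟨i, hi⟩ := i
  induction i using Nat.strong_induction_on with
  | _ i ih =>
    obtain ⟨u, rest, hu, hrest⟩ := hgreedy i hi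
    have hprev : ∀ i' (h : i' < i), ∃ (hl : i' < f.length), f[i'] = g (e ⟨i', h.trans hi⟩) := by
      intro i' h
      obtain ⟨r, hr⟩ := ih i' h (h.trans hi)
      have hl : i' < f.length := by
        by_contra hl
        rw [List.drop_eq_nil_of_le (not_lt.1 hl)] at hr
        simp at hr
      rw [List.drop_eq_getElem_cons hl] at hr
      exact ⟨hl, (List.cons.inj hr).1⟩
    have hil : i < f.length := by
      by_contra hl
      rw [List.drop_eq_nil_of_le (not_lt.1 hl)] at hu
      simp at hu
    have hui : f[i] = u := by
      rw [List.drop_eq_getElem_cons hil] at hu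
      exact (List.cons.inj hu).1
    have hcu : c (e ⟨i, hi⟩) (g (e ⟨i, hi⟩)) ≤ c (e ⟨i, hi⟩) u := by
      refine he _ u fun i' hi' h => ?_
      obtain ⟨hl, h'⟩ := hprev i' hi'
      rw [← hui, ← h'] at h
      have := (hf.getElem_inj_iff).1 h
      rw [Fin.lt_def] at hi'
      simp only at hi'
      omega
    have huc : c (e ⟨i, hi⟩) u ≤ c (e ⟨i, hi⟩) (g (e ⟨i, hi⟩)) := by
      obtain ⟨m, hm, hmg⟩ := List.mem_iff_getElem.1 (hall (g (e ⟨i, hi⟩)))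
      rcases Nat.lt_or_ge m i with h | h
      · obtain ⟨hl, h'⟩ := hprev m h
        rw [hmg] at h'
        have := e.injective (hg h')
        simp only [Fin.mk.injEq] at this
        omega
      · have hmem : g (e ⟨i, hi⟩) ∈ f.drop i := by
          rw [List.mem_iff_getElem]
          refine ⟨m - i, by simp; omega, ?_⟩
          rw [List.getElem_drop]
          simp only [Nat.add_sub_cancel' h, hmg]
        rw [hu] at hmem
        rcases List.mem_cons.1 hmem with h | h
        · rw [h]
        · have := hrest _ h
          rwa [hcost ⟨i, hi⟩] at this
    exact ⟨rest, by rw [hu, hc _ (le_antisymm hcu huc)]⟩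

/-! ### Weights of greedy plans -/

namespace Schema

variable {k n : ℕ} (W : Schema (Fin k) (Fin n))

/-- The cost of giving the block `φ ⁻¹ {j}` to the user `u`. -/
def blockCost (φ : Fin k → Fin k) (j : Fin k) (u : Fin n) : ℚ≥0 :=
  W.omega (Finset.univ.filter fun s => φ s = j) u

/-- The cost of giving a block to a user, with the name of the user as a tie-breaker. -/
def lexCost (φ : Fin k → Fin k) (j : Fin k) (u : Fin n) : ℚ≥0 ×ₗ ℕ :=
  toLex (W.blockCost φ j u, (u : ℕ))

theorem lexCost_injective (φ : Fin k → Fin k) (j : Fin k) :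
    Function.Injective (W.lexCost φ j) := by
  intro u v h
  exact Fin.ext (congrArg (fun x => (ofLex x).2) h)

theorem ofLex_sum_lexCost (φ : Fin k → Fin k) (g : Fin k → Fin n) :
    (ofLex (∑ j, W.lexCost φ j (g j))).1 = ∑ j, W.blockCost φ j (g j) := by
  have : ∀ s : Finset (Fin k), (ofLex (∑ j ∈ s, W.lexCost φ j (g j))).1 =
      ∑ j ∈ s, W.blockCost φ j (g j) := by
    intro s
    classical
    induction s using Finset.induction_on with
    | empty => rfl
    | insert a s ha ih =>
      rw [Finset.sum_insert ha, Finset.sum_insert ha, ← ih]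
      rfl
  exact this _

theorem authWeight_comp {f : Fin k → Fin n} (hf : Function.Injective f) (φ : Fin k → Fin k) :
    W.authWeight (f ∘ φ) = ∑ j, W.blockCost φ j (f j) := by
  refine (Fintype.sum_of_injective f hf _ _ (fun u hu => ?_) fun j => ?_).symm
  · have : (Finset.univ.filter fun s => (f ∘ φ) s = u) = ∅ := by
      ext s
      simp only [Finset.mem_filter, Finset.mem_univ, true_and, Finset.notMem_empty, iff_false]
      exact fun h => hu ⟨φ s, h⟩
    rw [this, W.omega_empty]
  · simp only [blockCost, Function.comp_apply, hf.eq_iff]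

/-- By user-independence, the constraint weight depends only on the partition into blocks. -/
theorem constraintWeight_comp (hUI : W.UserIndependent) {f g : Fin k → Fin n}
    (hf : Function.Injective f) (hg : Function.Injective g) (φ : Fin k → Fin k) :
    W.constraintWeight (f ∘ φ) = W.constraintWeight (g ∘ φ) := by
  obtain ⟨θ, hθ⟩ : ∃ θ : Equiv.Perm (Fin n), ∀ j, θ (f j) = g j := by
    classical
    let e : Set.range f ≃ Set.range g :=
      (Equiv.ofInjective f hf).symm.trans (Equiv.ofInjective g hg)
    refine ⟨e.extendSubtype, fun j => ?_⟩
    rw [e.extendSubtype_apply_of_mem _ ⟨j, rfl⟩]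
    simp [e]
  refine Finset.sum_congr rfl fun c hc => ?_
  rw [hUI c hc θ (f ∘ φ)]
  congr 1
  ext s
  simp [hθ]

/-- The comparison of plans by their authorization weights. -/
def authLE (π π' : Fin k → Fin n) : Bool := decide (W.authWeight π ≤ W.authWeight π')

theorem exists_factorization (hkn : k < n) (π : Fin k → Fin n) :
    ∃ (φ : Fin k → Fin k) (g : Fin k → Fin n), Function.Injective g ∧ g ∘ φ = π := by
  classical
  obtain ⟨t, ht, htc⟩ := Finset.exists_superset_card_eq (s := Finset.univ.image π) (n := k)
    (by simpa using Finset.card_image_le (s := Finset.univ) (f := π)) (by simpa using hkn.le)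
  let e := t.orderIsoOfFin htc
  have hmem : ∀ s, π s ∈ t := fun s => ht (Finset.mem_image_of_mem _ (Finset.mem_univ _))
  refine ⟨fun s => e.symm ⟨π s, hmem s⟩, fun j => e j, ?_, ?_⟩
  · exact Subtype.val_injective.comp e.injective
  · ext s
    simp

variable [NeZero n]

theorem planOf_eq_comp {φ : Fin k → Fin k} {f : List (Fin n)} (hf : f.Nodup) (hk : k ≤ f.length) :
    Function.Injective (fun j : Fin k => (f.drop j).headD 0) ∧
      planOf φ f = (fun j : Fin k => (f.drop j).headD 0) ∘ φ := by
  refine ⟨fun a b hab => ?_, rfl⟩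
  simp only at hab
  rw [List.drop_eq_getElem_cons (a.2.trans_le hk), List.drop_eq_getElem_cons (b.2.trans_le hk)]
    at hab
  exact Fin.ext ((hf.getElem_inj_iff).1 hab)

/-- The comparison of two plans that differ in one block compares the costs of this block. -/
theorem betterUser_iff (φ : Fin k → Fin k) {T : List (Fin n)} {u v : Fin n}
    {rest : List (Fin n)} (hnd : (T.reverse ++ u :: v :: rest).Nodup) (hT : T.length < k)
    (hlen : k < (T.reverse ++ u :: v :: rest).length) :
    betterUser W.authLE φ T u v rest = true ↔
      W.lexCost φ ⟨T.length, hT⟩ u ≤ W.lexCost φ ⟨T.length, hT⟩ v := by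
  have hsum : ∀ w : Fin n, (T.reverse ++ w :: rest).Nodup →
      W.authWeight (planOf φ (T.reverse ++ w :: rest)) =
        W.blockCost φ ⟨T.length, hT⟩ w + ∑ j ∈ Finset.univ.erase ⟨T.length, hT⟩,
          W.blockCost φ j (((T.reverse ++ u :: rest).drop j).headD 0) := by
    intro w hw
    obtain ⟨h₁, h₂⟩ := planOf_eq_comp (φ := φ) (k := k) hw (by simp at hlen ⊢; omega)
    rw [h₂, W.authWeight_comp h₁, ← Finset.add_sum_erase _ _ (Finset.mem_univ ⟨T.length, hT⟩)]
    congr 1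
    · simp
    · refine Finset.sum_congr rfl fun j hj => ?_
      have hne : (j : ℕ) ≠ T.length := fun h => Finset.ne_of_mem_erase hj (Fin.ext h)
      congr 1
      rcases Nat.lt_or_ge j T.length with h | h
      · have h' : (j : ℕ) < T.reverse.length := by simpa using h
        rw [List.drop_append_of_le_length h'.le, List.drop_append_of_le_length h'.le,
          List.drop_eq_getElem_cons h']
        rfl
      · obtain ⟨m, hm⟩ : ∃ m, (j : ℕ) = T.reverse.length + (m + 1) :=
          ⟨j - T.length - 1, by simp; omega⟩
        rw [hm, List.drop_append, List.drop_append]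
        simp
  have hu : (T.reverse ++ u :: rest).Nodup :=
    hnd.sublist ((((List.Sublist.refl rest).cons v).cons_cons u).append_left _)
  have hv : (T.reverse ++ v :: rest).Nodup :=
    hnd.sublist (((List.Sublist.refl _).cons u).append_left _)
  simp only [betterUser, authLE, hsum u hu, hsum v hv, decide_eq_true_eq, add_le_add_iff_right,
    lexCost, Prod.Lex.toLex_le_toLex]
  rcases lt_trichotomy (W.blockCost φ ⟨T.length, hT⟩ u) (W.blockCost φ ⟨T.length, hT⟩ v) with
    h | h | h
  · simp [h, h.le, h.not_ge]
  · simp [h]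
  · simp [h.not_ge, h.not_gt, h.ne']

/-- Some greedy plan is at least as good as a given plan. -/
theorem exists_greedyPlan_le (hUI : W.UserIndependent) (hkn : k < n) (π : Fin k → Fin n) :
    ∃ φ : Fin k → Fin k, W.constraintWeight (greedyPlan W.authLE φ) = W.constraintWeight π ∧
      W.authWeight (greedyPlan W.authLE φ) ≤ W.authWeight π := by
  obtain ⟨φ₀, g₀, hg₀, rfl⟩ := exists_factorization hkn π
  obtain ⟨g, hg, hopt⟩ : ∃ g : Fin k → Fin n, Function.Injective g ∧
      ∀ g' : Fin k → Fin n, Function.Injective g' →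
        ∑ j, W.lexCost φ₀ j (g j) ≤ ∑ j, W.lexCost φ₀ j (g' j) :=
    Set.exists_min_image {g | Function.Injective g}
      (fun g : Fin k → Fin n => ∑ j, W.lexCost φ₀ j (g j)) (Set.toFinite _) ⟨g₀, hg₀⟩
  obtain ⟨e, he⟩ := exists_order_of_optimal hg hopt
  have hblock : ∀ j u, W.lexCost (e.symm ∘ φ₀) j u = W.lexCost φ₀ (e j) u := by
    intro j u
    simp only [lexCost, blockCost, Function.comp_apply, Equiv.symm_apply_eq]
  refine ⟨e.symm ∘ φ₀, ?_⟩
  let cost : ℕ → Fin n → ℚ≥0 ×ₗ ℕ := fun j u =>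
    if h : j < k then W.lexCost (e.symm ∘ φ₀) ⟨j, h⟩ u else 0
  have hspec := dictatorship_spec (d := (0 : Fin n)) (better := betterUser W.authLE (e.symm ∘ φ₀))
    (cost := cost) (clock := List.finRange n) (turns := List.replicate k ())
    (users := List.finRange n) le_rfl (by simpa using hkn) (by
      intro T u v rest hT hp
      rw [List.length_replicate] at hT
      simp only [cost, hT, dif_pos]
      refine W.betterUser_iff _ (hp.nodup_iff.2 (List.nodup_finRange n)) hT ?_
      rw [hp.length_eq, List.length_finRange]
      exact hkn)
  set f := dictatorship (0 : Fin n) (betterUser W.authLE (e.symm ∘ φ₀)) (List.finRange n)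
    (List.replicate k ()) (List.finRange n) with hf
  obtain ⟨hp, hgreedy⟩ := hspec
  rw [List.length_replicate] at hgreedy
  have hget := hgreedy.drop_eq (c := W.lexCost φ₀) (g := g) (W.lexCost_injective φ₀) hg he
    (fun i => by
      funext u
      simp only [cost, i.2, dif_pos, Fin.eta]
      exact hblock i u)
    (hp.nodup_iff.2 (List.nodup_finRange n)) (fun u => hp.mem_iff.2 (List.mem_finRange u))
  have hplan : greedyPlan W.authLE (e.symm ∘ φ₀) = g ∘ φ₀ := by
    funext s
    obtain ⟨rest, hrest⟩ := hget (e.symm (φ₀ s))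
    simp only [greedyPlan, planOf, ← hf, Function.comp_apply, hrest, List.headD_cons,
      Equiv.apply_symm_apply]
  rw [hplan]
  refine ⟨W.constraintWeight_comp hUI hg hg₀ φ₀, ?_⟩
  rw [W.authWeight_comp hg, W.authWeight_comp hg₀, ← ofLex_sum_lexCost, ← ofLex_sum_lexCost]
  exact Prod.Lex.monotone_fst_ofLex (hopt g₀ hg₀)

end Schema

/-! ### Pareto fronts -/

namespace Schema

variable {k n : ℕ} (W : Schema (Fin k) (Fin n))

/-- The comparison of plans by their constraint weights. -/
def constraintLE (π π' : Fin k → Fin n) : Bool :=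
  decide (W.constraintWeight π ≤ W.constraintWeight π')

/-- The lexicographic comparison of plans by their constraint weights and, in case of a tie, by
their authorization weights. -/
def lexLE (π π' : Fin k → Fin n) : Bool :=
  W.constraintLE π π' && (!W.constraintLE π' π || W.authLE π π')

theorem lexLE_iff (π π' : Fin k → Fin n) : W.lexLE π π' = true ↔
    W.constraintWeight π < W.constraintWeight π' ∨
      W.constraintWeight π = W.constraintWeight π' ∧ W.authWeight π ≤ W.authWeight π' := by
  simp only [lexLE, constraintLE, authLE, Bool.and_eq_true, Bool.or_eq_true, Bool.not_eq_true',
    decide_eq_true_eq, decide_eq_false_iff_not, not_le]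
  constructor
  · rintro ⟨h₁, h₂ | h₂⟩
    · exact Or.inl h₂
    · exact h₁.lt_or_eq.imp_right fun h => ⟨h, h₂⟩
  · rintro (h | ⟨h₁, h₂⟩)
    · exact ⟨h.le, Or.inl h⟩
    · exact ⟨h₁.le, Or.inr h₂⟩

/-- The sweep over a sorted list keeps, for each plan, one that is at least as good in both weights;
the authorization weights of the plans that are kept decrease and their constraint weights
increase. -/
theorem sweep_spec (l o : List (Fin k → Fin n)) (hl : l.Pairwise fun π π' => W.lexLE π π' = true)
    (hol : ∀ y ∈ o, ∀ x ∈ l, W.lexLE y x = true)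
    (ho : o.Pairwise fun x y => W.authWeight x < W.authWeight y ∧
      W.constraintWeight y < W.constraintWeight x) :
    ((l.foldl (sweepStep W.authLE) o).Pairwise fun x y => W.authWeight x < W.authWeight y ∧
      W.constraintWeight y < W.constraintWeight x) ∧
    ∀ z, z ∈ o ∨ z ∈ l → ∃ y ∈ l.foldl (sweepStep W.authLE) o,
      W.constraintWeight y ≤ W.constraintWeight z ∧ W.authWeight y ≤ W.authWeight z := by
  induction l generalizing o with
  | nil => exact ⟨ho, fun z hz => ⟨z, by simpa using hz, le_rfl, le_rfl⟩⟩
  | cons x l ih =>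
    rw [List.pairwise_cons] at hl
    rw [List.foldl_cons]
    suffices hkeep : ∃ o', sweepStep W.authLE o x = o' ∧
        (∀ y ∈ o, y ∈ o') ∧ (∀ y ∈ o', y = x ∨ y ∈ o) ∧
        (∃ y ∈ o', W.constraintWeight y ≤ W.constraintWeight x ∧
          W.authWeight y ≤ W.authWeight x) ∧
        (o'.Pairwise fun x y => W.authWeight x < W.authWeight y ∧
          W.constraintWeight y < W.constraintWeight x) by
      obtain ⟨_, rfl, h₁, h₂, ⟨y, hy, hyC, hyA⟩, h₄⟩ := hkeep
      obtain ⟨hp, hd⟩ := ih (sweepStep W.authLE o x) hl.2 (by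
        intro y hy z hz
        rcases h₂ y hy with rfl | hy
        · exact hl.1 z hz
        · exact hol y hy z (List.mem_cons_of_mem _ hz)) h₄
      refine ⟨hp, fun z hz => ?_⟩
      rcases hz with hz | hz
      · exact hd z (Or.inl (h₁ z hz))
      · rcases List.mem_cons.1 hz with rfl | hz
        · obtain ⟨w, hw, hwC, hwA⟩ := hd y (Or.inl hy)
          exact ⟨w, hw, hwC.trans hyC, hwA.trans hyA⟩
        · exact hd z (Or.inr hz)
    match o with
    | [] =>
      exact ⟨[x], rfl, by simp, by simp, ⟨x, by simp, le_rfl, le_rfl⟩, by simp⟩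
    | y :: o =>
      have hyx := (W.lexLE_iff _ _).1 (hol y (by simp) x (by simp))
      by_cases h : W.authLE y x = true
      · refine ⟨y :: o, by simp [sweepStep, h], fun _ => id, fun _ => Or.inr,
          ⟨y, by simp, ?_, by simpa [authLE] using h⟩, ho⟩
        rcases hyx with h | h
        · exact h.le
        · exact h.1.le
      · refine ⟨x :: y :: o, by simp [sweepStep, h],
          fun _ h => List.mem_cons_of_mem _ h, fun _ => List.mem_cons.1,
          ⟨x, by simp, le_rfl, le_rfl⟩, ?_⟩
        have hA : W.authWeight x < W.authWeight y := by simpa [authLE] using h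
        have hC : W.constraintWeight y < W.constraintWeight x := by
          rcases hyx with h | h
          · exact h
          · exact absurd h.2 hA.not_ge
        refine List.pairwise_cons.2 ⟨fun z hz => ?_, ho⟩
        rcases List.mem_cons.1 hz with rfl | hz
        · exact ⟨hA, hC⟩
        · have := (List.pairwise_cons.1 ho).1 z hz
          exact ⟨hA.trans this.1, this.2.trans hC⟩

/-- A list of plans along which one weight decreases and the other one increases, and which contains
for each plan one that is at least as good, is a Pareto front. -/
theorem isParetoFront_of_pairwise {L : List (Fin k → Fin n)}
    (hL : L.Pairwise fun x y => W.authWeight x < W.authWeight y ∧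
      W.constraintWeight y < W.constraintWeight x)
    (hdom : ∀ z : Fin k → Fin n, ∃ y ∈ L,
      W.constraintWeight y ≤ W.constraintWeight z ∧ W.authWeight y ≤ W.authWeight z) :
    L.Nodup ∧ W.IsParetoFront {π | π ∈ L} := by
  have hne : ∀ x ∈ L, ∀ y ∈ L, x ≠ y →
      (W.authWeight x < W.authWeight y ∧ W.constraintWeight y < W.constraintWeight x) ∨
      (W.authWeight y < W.authWeight x ∧ W.constraintWeight x < W.constraintWeight y) := by
    intro x hx y hy hxy
    obtain ⟨a, ha, rfl⟩ := List.mem_iff_getElem.1 hx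
    obtain ⟨b, hb, rfl⟩ := List.mem_iff_getElem.1 hy
    rcases lt_trichotomy a b with h | rfl | h
    · exact Or.inl (List.pairwise_iff_getElem.1 hL a b ha hb h)
    · exact absurd rfl hxy
    · exact Or.inr (List.pairwise_iff_getElem.1 hL b a hb ha h)
  refine ⟨hL.imp fun h => ?_, ⟨fun π hπ => ?_, fun π hπ π' hπ' hne' hw => ?_⟩, ?_⟩
  · rintro rfl
    exact lt_irrefl _ h.1
  · rintro ⟨π', hC, hA, hlt⟩
    obtain ⟨y, hy, hyC, hyA⟩ := hdom π'
    by_cases hyπ : y = π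
    · subst hyπ
      exact absurd hlt (not_lt.2 (add_le_add hyC hyA))
    · rcases hne y hy π hπ hyπ with h | h
      · exact absurd (hyC.trans hC) (not_le.2 h.2)
      · exact absurd (hyA.trans hA) (not_le.2 h.1)
  · rcases hne π hπ π' hπ' hne' with h | h
    · exact h.1.ne hw.2
    · exact h.1.ne' hw.2
  · rintro G ⟨hG, hpair⟩ hle π hπ
    obtain ⟨y, hy, hyC, hyA⟩ := hdom π
    have hsum : W.constraintWeight π + W.authWeight π ≤ W.constraintWeight y + W.authWeight y := by
      by_contra h
      exact hG π hπ ⟨y, hyC, hyA, not_le.1 h⟩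
    have hC : W.constraintWeight π = W.constraintWeight y := by
      refine le_antisymm ?_ hyC
      by_contra h
      exact absurd hsum (not_le.2 (add_lt_add_of_lt_of_le (not_le.1 h) hyA))
    have hA : W.authWeight π = W.authWeight y := by
      refine le_antisymm ?_ hyA
      by_contra h
      exact absurd hsum (not_le.2 (add_lt_add_of_le_of_lt hyC (not_le.1 h)))
    by_contra hπL
    exact hpair hπ (hle hy) (fun h => hπL (h ▸ hy)) ⟨hC, hA⟩

end Schema

/-! ### The candidates -/

theorem exists_allPlans (k m : ℕ) : ∃ L : List (Fin k → Fin m),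
    L.map (fun π => List.ofFn fun s => (π s : ℕ)) =
      tuples (List.range m) (List.replicate k ()) := by
  have h : tuples (List.range m) (List.replicate k ()) ∈
      Set.range (List.map fun π : Fin k → Fin m => List.ofFn fun s => (π s : ℕ)) := by
    rw [Set.range_list_map]
    intro t ht
    obtain ⟨hlen, hlt⟩ := mem_tuples.1 ht
    rw [List.length_replicate] at hlen
    subst hlen
    refine ⟨fun s => ⟨t[s], List.mem_range.1 (hlt _ (List.getElem_mem _))⟩, ?_⟩
    simp
  exact h

/-- A list of all functions from `k` steps to `m` users, in the order of the enumeration of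
tuples. -/
noncomputable def allPlans (k m : ℕ) : List (Fin k → Fin m) := (exists_allPlans k m).choose

theorem map_allPlans (k m : ℕ) :
    (allPlans k m).map (fun π => List.ofFn fun s => (π s : ℕ)) =
      tuples (List.range m) (List.replicate k ()) := (exists_allPlans k m).choose_spec

theorem length_allPlans (k m : ℕ) : (allPlans k m).length = m ^ k := by
  have := congrArg List.length (map_allPlans k m)
  simpa [length_tuples] using this

theorem mem_allPlans {k m : ℕ} (π : Fin k → Fin m) : π ∈ allPlans k m := by
  have h : (List.ofFn fun s => (π s : ℕ)) ∈ tuples (List.range m) (List.replicate k ()) := by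
    rw [mem_tuples]
    refine ⟨by simp, fun u hu => ?_⟩
    obtain ⟨s, rfl⟩ := (List.mem_ofFn' _ _).1 hu
    simp
  rw [← map_allPlans, List.mem_map] at h
  obtain ⟨π', hπ', he⟩ := h
  have : π' = π := by
    funext s
    exact Fin.ext (congrFun (List.ofFn_injective he) s)
  exact this ▸ hπ'

theorem ofPlans_allPlans (k m : ℕ) : Data.ofPlans (allPlans k m) =
    .ofList ((tuples (List.range m) (List.replicate k ())).map .ofNats) := by
  rw [← map_allPlans, Data.ofPlans, List.map_map]
  congr 2
  funext π
  simp [Data.ofPlan, Data.ofNats, List.map_ofFn, Function.comp_def]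

/-- The candidates for the Pareto front: with at most `k` users, these are all plans; with more
users, they are the greedy plans for all ordered partitions of the steps. -/
noncomputable def Schema.candidates {k n : ℕ} (W : Schema (Fin k) (Fin n)) :
    List (Fin k → Fin n) :=
  if h : k < n then
    haveI : NeZero n := ⟨by omega⟩
    (allPlans k k).map (greedyPlan W.authLE)
  else allPlans k n

theorem Schema.length_candidates_le {k n : ℕ} (W : Schema (Fin k) (Fin n)) :
    W.candidates.length ≤ k ^ k := by
  unfold candidates
  split
  · simp [length_allPlans]
  · rw [length_allPlans]
    exact Nat.pow_le_pow_left (by omega) k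

theorem Schema.exists_candidate_le {k n : ℕ} (W : Schema (Fin k) (Fin n))
    (hUI : W.UserIndependent) (π : Fin k → Fin n) : ∃ π' ∈ W.candidates,
      W.constraintWeight π' ≤ W.constraintWeight π ∧ W.authWeight π' ≤ W.authWeight π := by
  unfold candidates
  split
  · rename_i h
    have : NeZero n := ⟨by omega⟩
    obtain ⟨φ, h₁, h₂⟩ := W.exists_greedyPlan_le hUI h π
    exact ⟨_, List.mem_map_of_mem (mem_allPlans φ), h₁.le, h₂⟩
  · exact ⟨π, mem_allPlans π, le_rfl, le_rfl⟩

/-- The Pareto front that is computed. -/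
noncomputable def Schema.front {k n : ℕ} (W : Schema (Fin k) (Fin n)) : List (Fin k → Fin n) :=
  (sortBy W.lexLE W.candidates).foldl (sweepStep W.authLE) []

theorem Schema.front_spec {k n : ℕ} (W : Schema (Fin k) (Fin n)) (hUI : W.UserIndependent) :
    W.front.Nodup ∧ W.IsParetoFront {π | π ∈ W.front} := by
  obtain ⟨h₁, h₂⟩ := W.sweep_spec (sortBy W.lexLE W.candidates) []
    (pairwise_sortBy W.lexLE (by
      intro a b c
      simp only [lexLE_iff]
      rintro (h | ⟨h, h'⟩) (h'' | ⟨h'', h'''⟩)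
      · exact Or.inl (h.trans h'')
      · exact Or.inl (h'' ▸ h)
      · exact Or.inl (h ▸ h'')
      · exact Or.inr ⟨h.trans h'', h'.trans h'''⟩) (by
      intro a b
      rw [Bool.or_eq_true, lexLE_iff, lexLE_iff]
      rcases lt_trichotomy (W.constraintWeight a) (W.constraintWeight b) with h | h | h
      · exact Or.inl (Or.inl h)
      · exact (le_total (W.authWeight a) (W.authWeight b)).imp (fun h' => Or.inr ⟨h, h'⟩)
          fun h' => Or.inr ⟨h.symm, h'⟩
      · exact Or.inr (Or.inl h)) _) (by simp) (by simp)
  refine W.isParetoFront_of_pairwise h₁ fun z => ?_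
  obtain ⟨c, hc, hcC, hcA⟩ := W.exists_candidate_le hUI z
  obtain ⟨y, hy, hyC, hyA⟩ := h₂ c (Or.inr ((sortBy_perm _ _).mem_iff.2 hc))
  exact ⟨y, hy, hyC.trans hcC, hyA.trans hcA⟩

/-! ### Running the whole algorithm -/

namespace InstanceClass

open Computes

variable {I : Type*} (F : InstanceClass I)

theorem computes_k : Computes (fun _ => True) 0 F.size F.input fun i => .ofUnary (F.k i) :=
  Computes.id.fst

theorem computes_n : Computes (fun _ => True) 0 F.size F.input fun i => .ofUnary (F.n i) :=
  Computes.id.snd.fst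

theorem k_add_n_le (i : I) : F.k i + F.n i ≤ F.size i := by
  simp only [size]
  omega

theorem computes_users :
    Computes (fun _ => True) 0 F.size F.input fun i => .ofUsers (List.finRange (F.n i)) := by
  refine (range.call' (fun i => F.n i) F.computes_n fun i _ => ⟨trivial, le_rfl, ?_⟩).congr ?_
  · have := F.k_add_n_le i
    omega
  · intro i _
    rw [Data.ofUsers, Data.ofNats, ← List.map_coe_finRange_eq_range, List.map_map]
    rfl

theorem computes_allPlans (m : I → ℕ) (hm : ∀ i, m i ≤ F.size i)
    (h : Computes (fun _ => True) 0 F.size F.input fun i => .ofUnary (m i)) :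
    Computes (fun _ => True) (fun i => m i ^ F.k i) F.size F.input
      fun i => .ofPlans (allPlans (F.k i) (m i)) := by
  have h' : Computes (fun _ => True) (fun i => m i ^ F.k i) F.size F.input
      fun i => .cons (.ofUnary (F.k i)) (.ofUnary (m i)) :=
    (F.computes_k.pair h).mono (fun _ => _root_.id) fun _ _ => Nat.zero_le _
  refine (computes_tuples.call (fun i => (F.k i, m i)) (2 * X + 1) h' fun i _ => ?_).congr
    fun i _ => (ofPlans_allPlans _ _).symm
  have := F.k_add_n_le i
  have := hm i
  refine ⟨trivial, ?_, ?_⟩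
  · simp only [eval_add, eval_mul, eval_X, eval_ofNat, eval_one]
    nlinarith [Nat.zero_le ((m i ^ F.k i + 1) * (2 * F.size i))]
  · simp only [eval_add, eval_mul, eval_X, eval_ofNat, eval_one]
    omega

theorem computes_greedyPlans {F : InstanceClass I} [∀ i, NeZero (F.n i)]
    (hA : F.PolyTimeComputable fun i π => (F.schema i).authWeight π) :
    Computes (fun _ => True) (fun i => F.k i ^ F.k i) F.size F.input
      fun i => .ofPlans ((allPlans (F.k i) (F.k i)).map (greedyPlan (F.schema i).authLE)) := by
  have hplans := F.computes_allPlans F.k (fun i => by have := F.k_add_n_le i; omega) F.computes_k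
  have hgreedy : Computes (fun _ => True) 0
      (fun y : Σ i, Fin (F.k i) → Fin (F.k i) => F.size y.1)
      (fun y => .cons (F.input y.1) (.ofPlan y.2))
      (fun y => .ofPlan (greedyPlan (F.schema y.1).authLE y.2)) :=
    computes_greedyPlan (le := fun i => (F.schema i).authLE) F.k_add_n_le F.computes_k F.computes_users
      hA.computes_le
  have h := map (D := fun _ => True) (M := fun i => F.k i ^ F.k i) (N := F.size) (a := F.input)
    (M₂ := 0) (β := fun i => Fin (F.k i) → Fin (F.k i))
    (γ := fun i => Fin (F.k i) → Fin (F.n i)) (fun _ => .ofPlan) (fun _ => .ofPlan)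
    (fun i => allPlans (F.k i) (F.k i)) (fun i => greedyPlan (F.schema i).authLE) 1 hplans
    (hgreedy.mono (fun _ _ => trivial) fun _ _ => le_rfl)
    (fun i _ => by simp [length_allPlans])
  exact h

/-- The instances with more users than steps. -/
def manyUsers : InstanceClass {i // F.k i < F.n i} where
  k i := F.k i
  n i := F.n i
  schema i := F.schema i
  desc i := F.desc i

theorem computes_candidates {F : InstanceClass I}
    (hA : F.PolyTimeComputable fun i π => (F.schema i).authWeight π) :
    Computes (fun _ => True) (fun i => F.k i ^ F.k i) F.size F.input
      fun i => .ofPlans (F.schema i).candidates := by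
  have htest : Computes (fun _ => True) (fun i => F.k i ^ F.k i) F.size F.input
      fun i => .ofList ((List.replicate (F.n i) Data.nil).drop (F.k i)) := by
    refine (drop.call' (fun i => (F.k i, List.replicate (F.n i) Data.nil))
      (F.computes_k.pair F.computes_n) fun i _ => ⟨trivial, le_rfl, ?_⟩).mono
      (fun _ => _root_.id) fun _ _ => Nat.zero_le _
    have := F.k_add_n_le i
    simp only
    omega
  refine (ite (p := fun i => F.k i < F.n i) htest ?_ (b := fun i => .ofPlans (F.schema i).candidates)
    (d := fun i => .ofPlans (F.schema i).candidates) ?_ ?_).congr fun i _ => ite_self _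
  · intro i _
    simp [Data.ofList_eq_nil_iff, Nat.sub_eq_zero_iff_le]
  · have : ∀ i, NeZero (F.manyUsers.n i) := fun i => ⟨(Nat.zero_le _).trans_lt i.2 |>.ne'⟩
    have hA' : F.manyUsers.PolyTimeComputable fun i π => (F.manyUsers.schema i).authWeight π := by
      obtain ⟨Q, q, h⟩ := hA
      exact ⟨Q, q, fun i => h i⟩
    refine (computes_greedyPlans hA').sub (X + 1) ?_
    rintro i ⟨-, hi⟩
    refine ⟨⟨i, hi⟩, trivial, rfl, ?_, ?_, ?_⟩
    · rw [Schema.candidates, dif_pos hi]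
      rfl
    · simp only [eval_add, eval_X, eval_one]
      exact Nat.le_mul_of_pos_right _ (by omega)
    · simp only [eval_add, eval_X, eval_one]
      exact Nat.le_succ _
  · refine (F.computes_allPlans F.n (fun i => by have := F.k_add_n_le i; omega)
      F.computes_n).sub (X + 1) ?_
    rintro i ⟨-, hi⟩
    have h := Nat.pow_le_pow_left (not_lt.1 hi) (F.k i)
    refine ⟨i, trivial, rfl, ?_, ?_, ?_⟩
    · rw [Schema.candidates, dif_neg hi]
    · simp only [eval_add, eval_X, eval_one]
      nlinarith [Nat.zero_le ((F.k i ^ F.k i + 1) * F.size i)]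
    · simp only [eval_add, eval_X, eval_one]
      exact Nat.le_succ _

theorem computes_front {F : InstanceClass I}
    (hA : F.PolyTimeComputable fun i π => (F.schema i).authWeight π)
    (hC : F.PolyTimeComputable fun i π => (F.schema i).constraintWeight π) :
    Computes (fun _ => True) (fun i => F.k i ^ F.k i) F.size F.input
      fun i => .ofPlans (F.schema i).front := by
  have hleA : Computes (fun _ => True) 0
      (fun y : Σ i, (Fin (F.k i) → Fin (F.n i)) × (Fin (F.k i) → Fin (F.n i)) => F.size y.1)
      (fun y => .cons (F.input y.1) (.cons (.ofPlan y.2.1) (.ofPlan y.2.2)))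
      (fun y => .ofBool ((F.schema y.1).authLE y.2.1 y.2.2)) := hA.computes_le
  have hleC : Computes (fun _ => True) 0
      (fun y : Σ i, (Fin (F.k i) → Fin (F.n i)) × (Fin (F.k i) → Fin (F.n i)) => F.size y.1)
      (fun y => .cons (F.input y.1) (.cons (.ofPlan y.2.1) (.ofPlan y.2.2)))
      (fun y => .ofBool ((F.schema y.1).constraintLE y.2.1 y.2.2)) := hC.computes_le
  have hlex : Computes (fun _ => True) 0
      (fun y : Σ i, (Fin (F.k i) → Fin (F.n i)) × (Fin (F.k i) → Fin (F.n i)) => F.size y.1)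
      (fun y => .cons (F.input y.1) (.cons (.ofPlan y.2.1) (.ofPlan y.2.2)))
      (fun y => .ofBool ((F.schema y.1).lexLE y.2.1 y.2.2)) := by
    refine boolOp and hleC (boolOp (fun a b => !a || b) ?_ hleA)
    exact hleC.call' (fun y : Σ i, (Fin (F.k i) → Fin (F.n i)) × (Fin (F.k i) → Fin (F.n i)) =>
      (⟨y.1, y.2.2, y.2.1⟩ : Σ i, (Fin (F.k i) → Fin (F.n i)) × (Fin (F.k i) → Fin (F.n i))))
      (Computes.id.fst.pair (Computes.id.snd.snd.pair Computes.id.snd.fst))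
      fun _ _ => ⟨trivial, le_rfl, le_rfl⟩
  have hsort : Computes (fun _ => True) (fun i => F.k i ^ F.k i) F.size F.input
      fun i => .ofList ((sortBy (F.schema i).lexLE (F.schema i).candidates).map .ofPlan) := by
    refine (computes_sortBy (enc := fun _ => .ofPlan) (size := F.size)
      (le := fun i => (F.schema i).lexLE) hlex).call
      (fun i => (⟨i, (F.schema i).candidates⟩ : Σ i, List (Fin (F.k i) → Fin (F.n i))))
      (2 * (X ^ 2 + 1) + X + 1) (Computes.id.pair (computes_candidates hA)) fun i _ => ?_
    have h₁ := (F.schema i).length_candidates_le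
    -- The number of rounds of merging is at most `log (k ^ k) ≤ k ^ 2`.
    have h₂ : Nat.clog 2 (F.schema i).candidates.length ≤ F.size i ^ 2 := by
      have h₃ : (F.schema i).candidates.length ≤ 2 ^ (F.k i * F.k i) := by
        refine h₁.trans ?_
        rw [pow_mul]
        exact Nat.pow_le_pow_left Nat.lt_two_pow_self.le _
      have h₄ : F.k i ≤ F.size i := by
        have := F.k_add_n_le i
        omega
      rw [sq]
      exact (Nat.clog_le_of_le_pow h₃).trans (Nat.mul_le_mul h₄ h₄)
    refine ⟨trivial, ?_, ?_⟩
    · simp only [eval_add, eval_mul, eval_X, eval_ofNat, eval_one, eval_pow]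
      have h₅ : (Nat.clog 2 (F.schema i).candidates.length + 1) *
          (2 * (F.schema i).candidates.length + 1) ≤
          (F.size i ^ 2 + 1) * (2 * F.k i ^ F.k i + 1) :=
        Nat.mul_le_mul (by omega) (by omega)
      nlinarith [Nat.zero_le ((F.k i ^ F.k i + 1) * F.size i), Nat.zero_le (F.size i ^ 2)]
    · simp only [eval_add, eval_mul, eval_X, eval_ofNat, eval_one, eval_pow]
      omega
  refine (computes_sweep (enc := fun _ => .ofPlan) (size := F.size)
    (le := fun i => (F.schema i).authLE) hleA).call'
    (fun i => (⟨i, sortBy (F.schema i).lexLE (F.schema i).candidates⟩ :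
      Σ i, List (Fin (F.k i) → Fin (F.n i)))) (Computes.id.pair hsort) fun i _ => ⟨trivial, ?_, le_rfl⟩
  simp only [(sortBy_perm _ _).length_eq]
  exact (F.schema i).length_candidates_le

end InstanceClass

theorem two_rpow_mul_logb (k : ℕ) :
    (2 : ℝ) ^ ((k : ℝ) * Real.logb 2 (k : ℝ)) = ((k ^ k : ℕ) : ℝ) := by
  rcases Nat.eq_zero_or_pos k with rfl | hk
  · simp
  · rw [mul_comm, Real.rpow_mul two_pos.le, Real.rpow_logb two_pos (by norm_num)
      (by exact_mod_cast hk)]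
    simp

end BOWSP

theorem mainTheorem1 {I : Type*} (F : BOWSP.InstanceClass I)
    (hUI : ∀ i, (F.schema i).UserIndependent)
    (hA : F.PolyTimeComputable fun i π => (F.schema i).authWeight π)
    (hC : F.PolyTimeComputable fun i π => (F.schema i).constraintWeight π) :
    ∃ (P : BOWSP.Prog) (p : Polynomial ℕ), ∀ i : I,
      ∃ (L : List (Fin (F.k i) → Fin (F.n i))) (t : ℕ),
        BOWSP.Runs P (F.input i) (BOWSP.Data.ofPlans L) t ∧
        L.Nodup ∧
        (F.schema i).IsParetoFront {π | π ∈ L} ∧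
        (t : ℝ) ≤ (2 : ℝ) ^ ((F.k i : ℝ) * Real.logb 2 (F.k i : ℝ)) * ((p.eval (F.size i) : ℕ) : ℝ) := by
  obtain ⟨P, p, hP⟩ := BOWSP.InstanceClass.computes_front hA hC
  refine ⟨P, 2 * p, fun i => ?_⟩
  obtain ⟨t, ht, ht'⟩ := hP i trivial
  obtain ⟨h₁, h₂⟩ := (F.schema i).front_spec (hUI i)
  refine ⟨_, t, ht, h₁, h₂, ?_⟩
  rw [BOWSP.two_rpow_mul_logb, ← Nat.cast_mul, Nat.cast_le]
  have hpos : 0 < F.k i ^ F.k i := Nat.pow_self_pos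
  rw [Polynomial.eval_mul, Polynomial.eval_ofNat]
  nlinarith [Nat.mul_le_mul_right (p.eval (F.size i)) hpos]
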